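/- Let $V\subset\mathbb{R}^2$ be a finite set of points, not all on one line, and let $s$ be a real-valued function that is convex on $\operatorname{conv}V$. Put $s_v=s(v)$. A triangulation of $V$ is a simplicial complex in the plane whose vertex set is exactly $V$ and whose underlying space is $\operatorname{conv}V$. A hinge $(i,j;k,l)$ of a planar simplicial complex consists of two different triangles $ijk$ and $ijl$ of the complex that share the edge $ij$; edges having a hinge are called interior edges. The conductivity of an interior edge $ij$ with hinge $(i,j;k,l)$ is given by the hinge formula $$q_{ij}=-\frac{\cot\theta_{ijk}+\cot\theta_{ijl}}{|e_{ij}|^2}\,s_i-\frac{\cot\theta_{jik}+\cot\theta_{jil}}{|e_{ij}|^2}\,s_j+\frac{1}{2|t_{ijk}|}\,s_k+\frac{1}{2|t_{ijl}|}\,s_l ,$$ where $|e_{ij}|$ is the length of the edge, $|t_{abc}|$ the area of the triangle $abc$ and $\theta_{abc}$ its interior angle at $b$. A complex is called $Q$-adapted if $q_{ij}\ge 0$ for all of its interior edges $ij$. The lower hull of the lifted points is the set of points $(x,z)$ of $C=\operatorname{conv}\{(v,s_v):v\in V\}\subset\mathbb{R}^3$ such that no $(x,z')\in C$ has $z'<z$;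 a complex with vertices in $V$ is called a projection of the lower hull if the union of its lifted simplices $\operatorname{conv}\{(v,s_v): v \text{ a vertex of the simplex}\}$ is the lower hull. Then: 1. There is a triangulation of $V$ that is a projection of the lower hull and is $Q$-adapted. 2. Every simplicial complex with vertices in $V$ that is a projection of the lower hull is $Q$-adapted. 3. For every hinge $(i,j;k,l)$ of a planar simplicial complex, $q_{ij}>0$ if and only if the lifted hinge is convex (some plane through $(i,s_i)$ and $(j,s_j)$ passes strictly below $(k,s_k)$ and $(l,s_l)$), and $q_{ij}=0$ if and only if the lifted hinge is flat (the four lifted points lie on one non-vertical plane). 4. If $K$ is a $Q$-adapted triangulation of $V$ with $q_{ij}\ne 0$ for all interior edges $ij$, then $K$ is the only $Q$-adapted triangulation of $V$. -/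

import Mathlib

namespace QAdapted

/-- The Euclidean plane. -/
abbrev Plane : Type := EuclideanSpace ℝ (Fin 2)

/-- A planar simplicial complex. -/
abbrev PlaneComplex : Type := Geometry.SimplicialComplex ℝ Plane

/-- `K` is a triangulation of the finite point set `V`: a simplicial complex whose vertices are
exactly the points of `V` and which tessellates the convex hull of `V`. -/
structure IsTriangulation (V : Finset Plane) (K : PlaneComplex) : Prop where
  vertices_eq : K.vertices = (V : Set Plane)
  space_eq : K.space = convexHull ℝ (V : Set Plane)

/-- `a`, `b`, `c` are the three distinct corners of a triangle (a two-dimensional face) of `K`. -/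
structure IsTriangle (K : PlaneComplex) (a b c : Plane) : Prop where
  ne_ab : a ≠ b
  ne_bc : b ≠ c
  ne_ac : a ≠ c
  face : ∃ t ∈ K.faces, (t : Set Plane) = {a, b, c}

/-- `i j` is an interior edge of `K`, that is, an edge with a complete hinge: `i j k` and `i j l`
are two different triangles of `K` that share the edge `i j`. -/
structure IsHinge (K : PlaneComplex) (i j k l : Plane) : Prop where
  left : IsTriangle K i j k
  right : IsTriangle K i j l
  ne : k ≠ l

/-- The (unsigned) area of the triangle with corners `a`, `b`, `c`. -/
noncomputable def triangleArea (a b c : Plane) : ℝ :=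
  |(b 0 - a 0) * (c 1 - a 1) - (b 1 - a 1) * (c 0 - a 0)| / 2

/-- The hinge formula: the conductivity `q_ij` of the edge `i j` with incident triangles `i j k`
and `i j l`, computed from the values of `s` at the nodes. The angle `θ_ijk` is the interior angle
of the triangle `i j k` at the vertex `j`, which is `EuclideanGeometry.angle i j k`. -/
noncomputable def hingeConductivity (s : Plane → ℝ) (i j k l : Plane) : ℝ :=
  - (1 / dist i j ^ 2) *
      (Real.cot (EuclideanGeometry.angle i j k) + Real.cot (EuclideanGeometry.angle i j l)) * s i
  - (1 / dist i j ^ 2) *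
      (Real.cot (EuclideanGeometry.angle j i k) + Real.cot (EuclideanGeometry.angle j i l)) * s j
  + 1 / (2 * triangleArea i j k) * s k
  + 1 / (2 * triangleArea i j l) * s l

/-- The lifted hinge is (strictly) convex along the edge `i j`: some plane through the two lifted
points over `i` and `j` passes strictly below the lifted points over `k` and `l`. -/
def HingeConvex (s : Plane → ℝ) (i j k l : Plane) : Prop :=
  ∃ f : Plane →ᵃ[ℝ] ℝ, f i = s i ∧ f j = s j ∧ f k < s k ∧ f l < s l

/-- The lifted hinge is flat: the four lifted points lie on one (non-vertical) plane. -/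
def HingeFlat (s : Plane → ℝ) (i j k l : Plane) : Prop :=
  ∃ f : Plane →ᵃ[ℝ] ℝ, f i = s i ∧ f j = s j ∧ f k = s k ∧ f l = s l

/-- `K` is `Q`-adapted (`Q` being the rotated Hessian of `s`): all edge conductivities given by the
hinge formula on the interior edges of `K` are non-negative. -/
def IsQAdapted (s : Plane → ℝ) (K : PlaneComplex) : Prop :=
  ∀ i j k l : Plane, IsHinge K i j k l → 0 ≤ hingeConductivity s i j k l

/-- Projection of a planar point up to the graph of `s`. -/
def lift (s : Plane → ℝ) (x : Plane) : Plane × ℝ := (x, s x)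

/-- The lower part of the boundary of the convex hull of the lifted points of `V`. -/
def lowerHull (s : Plane → ℝ) (V : Finset Plane) : Set (Plane × ℝ) :=
  {p | p ∈ convexHull ℝ (lift s '' (V : Set Plane)) ∧
    ∀ z : ℝ, (p.1, z) ∈ convexHull ℝ (lift s '' (V : Set Plane)) → p.2 ≤ z}

/-- `K` is obtained by triangulating the lower convex hull of the lifted points of `V` and
projecting back to the plane: its vertices are points of `V`, and its lifted simplices make up
the lower hull. -/
structure IsLowerHullProjection (s : Plane → ℝ) (V : Finset Plane) (K : PlaneComplex) : Prop where
  vertices_subset : K.vertices ⊆ (V : Set Plane)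
  lift_eq : ⋃ t ∈ K.faces, convexHull ℝ (lift s '' (t : Set Plane)) = lowerHull s V

end QAdapted

namespace QAdapted

/-! The conductivity of a hinge is an affine dependence in disguise: there are weights with `c • k +
d • l = a • i + b • j`, `c + d = a + b`, `c, d > 0`, and `q = c * s k + d * s l - a * s i - b * s j`
(`IsHinge.exists_weights`). Hence `q = c * (s k - f k) + d * (s l - f l)` for every affine `f` that
agrees with `s` at `i` and `j`, which gives the convex/flat criterion. For a projection of the lower
hull, a negative `q` would put a point of the hull strictly below the midpoint of a lifted edge.

Uniqueness rests on passing from local to global convexity. On a generic segment from a triangle to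
`v`, each crossing of an edge changes the value at `v` of the interpolating affine function by a
positive multiple of that edge's `q` (`exists_interpolation_add`). So in a `Q`-adapted triangulation
every interpolant lies below `s` on `V`, strictly off its own triangle when no `q` vanishes.
Comparing interpolants of two triangulations at a relative interior point of a face then forces the
faces to coincide.

For existence, the heights are perturbed to `s v + ε * ‖v‖ ^ 2 + ε ^ 2 * ψ v`. The quadratic term
keeps every point of `V` a vertex, and a generic `ψ` makes the contact sets of affine minorants
affinely independent, so these sets form a triangulation (`exists_regular_triangulation`). For small
`ε` its triangles also support the unperturbed `s`. -/

open Filter Topology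

/-! ### Coordinates, cotangents and degenerate triangles. -/

/-- Twice the signed area of the triangle `a b c`. -/
noncomputable def det (a b c : Plane) : ℝ :=
  (b 0 - a 0) * (c 1 - a 1) - (b 1 - a 1) * (c 0 - a 0)

lemma triangleArea_eq (a b c : Plane) : triangleArea a b c = |det a b c| / 2 := rfl

lemma plane_ext {x y : Plane} (h0 : x 0 = y 0) (h1 : x 1 = y 1) : x = y := by
  ext i
  fin_cases i
  · exact h0
  · exact h1

lemma inner_eq (x y : Plane) : inner ℝ x y = x 0 * y 0 + x 1 * y 1 := by
  simp [PiLp.inner_apply, Fin.sum_univ_two]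
  ring

lemma dist_sq_eq (x y : Plane) : dist x y ^ 2 = (x 0 - y 0) ^ 2 + (x 1 - y 1) ^ 2 := by
  rw [dist_eq_norm, ← real_inner_self_eq_norm_sq, inner_eq]
  simp
  ring

/-- The cotangent of an interior angle of a non-degenerate triangle. -/
lemma cot_angle {a b c : Plane} (hab : a ≠ b) (hcb : c ≠ b) :
    Real.cot (EuclideanGeometry.angle a b c) =
      ((a 0 - b 0) * (c 0 - b 0) + (a 1 - b 1) * (c 1 - b 1)) / |det a b c| := by
  have hx : a - b ≠ 0 := sub_ne_zero.2 hab
  have hy : c - b ≠ 0 := sub_ne_zero.2 hcb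
  have hn : ‖a - b‖ * ‖c - b‖ ≠ 0 := mul_ne_zero (norm_ne_zero_iff.2 hx) (norm_ne_zero_iff.2 hy)
  have hs := InnerProductGeometry.sin_angle_mul_norm_mul_norm (a - b) (c - b)
  have hc := InnerProductGeometry.cos_angle_mul_norm_mul_norm (a - b) (c - b)
  -- Lagrange's identity; it turns the square root in the sine formula into `|det a b c|`.
  have hd : inner ℝ (a - b) (a - b) * inner ℝ (c - b) (c - b)
      - inner ℝ (a - b) (c - b) * inner ℝ (a - b) (c - b) = det a b c ^ 2 := by
    simp only [inner_eq, det, PiLp.sub_apply]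
    ring
  rw [hd, Real.sqrt_sq_eq_abs] at hs
  rw [EuclideanGeometry.angle, Real.cot_eq_cos_div_sin, vsub_eq_sub, vsub_eq_sub,
    ← mul_div_mul_right _ _ hn, hs, hc, inner_eq]
  simp

/-- A triangle of zero signed area is degenerate. -/
lemma collinear_of_det_eq_zero {a b c : Plane} (hab : a ≠ b) (h : det a b c = 0) :
    Collinear ℝ ({a, b, c} : Set Plane) := by
  have hpos : (b 0 - a 0) ^ 2 + (b 1 - a 1) ^ 2 ≠ 0 := by
    intro h0
    apply hab
    apply plane_ext <;> nlinarith [sq_nonneg (b 0 - a 0), sq_nonneg (b 1 - a 1)]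
  -- The parameter is that of the orthogonal projection of `c` to the line `a b`.
  have hc : c = AffineMap.lineMap a b
      (((b 0 - a 0) * (c 0 - a 0) + (b 1 - a 1) * (c 1 - a 1)) /
        ((b 0 - a 0) ^ 2 + (b 1 - a 1) ^ 2)) := by
    unfold det at h
    apply plane_ext
    · simp [AffineMap.lineMap_apply]
      field_simp
      linear_combination (-(b 1 - a 1)) * h
    · simp [AffineMap.lineMap_apply]
      field_simp
      linear_combination (b 0 - a 0) * h
  rw [show ({a, b, c} : Set Plane) = {c, a, b} by
    ext x; simp only [Set.mem_insert_iff, Set.mem_singleton_iff]; tauto]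
  refine collinear_insert_of_mem_affineSpan_pair ?_
  rw [hc]
  exact AffineMap.lineMap_mem_affineSpan_pair _ _ _

lemma card_eq_three_of_coe_eq {t : Finset Plane} {a b c : Plane} (hab : a ≠ b) (hbc : b ≠ c)
    (hac : a ≠ c) (h : (t : Set Plane) = {a, b, c}) : t.card = 3 := by
  have : t = {a, b, c} := by
    apply Finset.coe_injective
    simpa using h
  rw [this, Finset.card_eq_three]
  exact ⟨a, b, c, hab, hac, hbc, rfl⟩

lemma not_collinear_of_indep {t : Finset Plane}
    (h : AffineIndependent ℝ ((↑) : t → Plane)) (ht : t.card = 3) :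
    ¬ Collinear ℝ (t : Set Plane) := by
  have hr : (t : Set Plane) = Set.range ((↑) : t → Plane) := Subtype.range_coe.symm
  rw [hr, collinear_iff_finrank_le_one]
  have := h.finrank_vectorSpan (n := 2) (by simp [ht])
  omega

lemma IsTriangle.det_ne_zero {K : PlaneComplex} {a b c : Plane} (h : IsTriangle K a b c) :
    det a b c ≠ 0 := by
  intro h0
  obtain ⟨t, ht, htt⟩ := h.face
  refine not_collinear_of_indep (K.indep ht)
    (card_eq_three_of_coe_eq h.ne_ab h.ne_bc h.ne_ac htt) ?_
  rw [htt]
  exact collinear_of_det_eq_zero h.ne_ab h0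

/-! ### Hinges and their affine dependence. -/

lemma mem_convexHull_triple {a b c x : Plane} {u v w : ℝ} (hu : 0 ≤ u) (hv : 0 ≤ v) (hw : 0 ≤ w)
    (h : u + v + w = 1) (hx : x = u • a + v • b + w • c) :
    x ∈ convexHull ℝ ({a, b, c} : Set Plane) := by
  rw [convexHull_insert (by simp), convexHull_pair, mem_convexJoin]
  simp only [Set.mem_singleton_iff, exists_eq_left]
  rcases eq_or_lt_of_le (show u ≤ 1 by linarith) with h1 | h1
  · have hv0 : v = 0 := by linarith
    have hw0 : w = 0 := by linarith
    subst h1 hv0 hw0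
    exact ⟨b, left_mem_segment _ _ _, by simpa [hx] using left_mem_segment ℝ a b⟩
  · have h2 : (0 : ℝ) < 1 - u := by linarith
    refine ⟨(v / (1 - u)) • b + (w / (1 - u)) • c,
      ⟨_, _, div_nonneg hv h2.le, div_nonneg hw h2.le, ?_, rfl⟩,
      ⟨u, 1 - u, hu, h2.le, by ring, ?_⟩⟩
    · field_simp
      linarith
    · rw [hx, smul_add, smul_smul, smul_smul, mul_div_cancel₀ _ h2.ne',
        mul_div_cancel₀ _ h2.ne', add_assoc]

/-- The two triangles of a hinge lie on opposite sides of the common edge. -/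
lemma IsHinge.det_mul_neg {K : PlaneComplex} {i j k l : Plane} (h : IsHinge K i j k l) :
    det i j k * det i j l < 0 := by
  have hk := h.left.det_ne_zero
  have hl := h.right.det_ne_zero
  by_contra hneg
  have hpos : 0 < det i j k * det i j l :=
    lt_of_le_of_ne (not_lt.1 hneg) (mul_ne_zero hk hl).symm
  obtain ⟨t, ht, htt⟩ := h.left.face
  obtain ⟨u, hu, huu⟩ := h.right.face
  have hγ : 0 < det i j k / det i j l := by
    rcases hl.lt_or_gt with hl' | hl'
    · exact div_pos_of_neg_of_neg (by nlinarith) hl'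
    · exact div_pos (by nlinarith) hl'
  set γ := det i j k / det i j l with hγ'
  set β := det i k l / det i j l with hβ'
  have hγl : γ * det i j l = det i j k := div_mul_cancel₀ _ hl
  have hβl : β * det i j l = det i k l := div_mul_cancel₀ _ hl
  -- Barycentric coordinates of `k` in the triangle `i j l`. If both corners lay on the same side,
  -- then `γ > 0`, and a point just off the midpoint of `i j` towards `k` would lie in both
  -- triangles.
  have hbary : k = (1 - β - γ) • i + β • j + γ • l := by
    unfold det at hγl hβl hl
    apply plane_ext
    · simp only [PiLp.add_apply, PiLp.smul_apply, smul_eq_mul]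
      apply mul_left_cancel₀ hl
      linear_combination (i 0 - j 0) * hβl + (i 0 - l 0) * hγl
    · simp only [PiLp.add_apply, PiLp.smul_apply, smul_eq_mul]
      apply mul_left_cancel₀ hl
      linear_combination (i 1 - j 1) * hβl + (i 1 - l 1) * hγl
  set α := 1 - β - γ with hα'
  set ε : ℝ := 1 / (2 + 2 * |α| + 2 * |β|) with hε'
  have hε : 0 < ε := by positivity
  have hεm : ε * (2 + 2 * |α| + 2 * |β|) = 1 := one_div_mul_cancel (by positivity)
  have h1 : 0 ≤ (1 - ε) / 2 + ε * α := by
    nlinarith [neg_abs_le α, abs_nonneg α, abs_nonneg β, mul_nonneg hε.le (abs_nonneg β),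
      mul_nonneg hε.le (show 0 ≤ α + |α| by linarith [neg_abs_le α])]
  have h2 : 0 ≤ (1 - ε) / 2 + ε * β := by
    nlinarith [neg_abs_le β, abs_nonneg α, abs_nonneg β, mul_nonneg hε.le (abs_nonneg α),
      mul_nonneg hε.le (show 0 ≤ β + |β| by linarith [neg_abs_le β])]
  have hε1 : ε ≤ 1 := by
    nlinarith [mul_nonneg hε.le (abs_nonneg α), mul_nonneg hε.le (abs_nonneg β)]
  set x : Plane := ((1 - ε) / 2) • i + ((1 - ε) / 2) • j + ε • k with hx
  have hxt : x ∈ convexHull ℝ (t : Set Plane) := by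
    rw [htt]
    exact mem_convexHull_triple (by linarith) (by linarith) hε.le (by ring) hx
  have hxu : x ∈ convexHull ℝ (u : Set Plane) := by
    rw [huu]
    refine mem_convexHull_triple h1 h2 (mul_pos hε hγ).le ?_ ?_
    · rw [hα']; ring
    · rw [hx]
      nth_rewrite 1 [hbary]
      module
  have hsub : (t ∩ u : Set Plane) ⊆ {i, j} := by
    rw [htt, huu]
    rintro y ⟨hy1, hy2⟩
    simp only [Set.mem_insert_iff, Set.mem_singleton_iff] at hy1 hy2 ⊢
    rcases hy1 with rfl | rfl | rfl
    · simp
    · simp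
    · rcases hy2 with h' | h' | h'
      · exact Or.inl h'
      · exact Or.inr h'
      · exact absurd h' h.ne
  have hxs := convexHull_mono hsub (K.inter_subset_convexHull ht hu ⟨hxt, hxu⟩)
  rw [convexHull_pair] at hxs
  obtain ⟨a, b, -, -, hab, hx'⟩ := hxs
  -- The function `det i j` vanishes on the line `i j`, but not at `x`.
  have hd1 : det i j x = ε * det i j k := by
    rw [hx]
    simp only [det, PiLp.add_apply, PiLp.smul_apply, smul_eq_mul]
    ring
  have hd2 : det i j x = 0 := by
    rw [← hx', show a = 1 - b by linarith]
    simp only [det, PiLp.add_apply, PiLp.smul_apply, smul_eq_mul]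
    ring
  exact mul_ne_zero hε.ne' hk (hd1 ▸ hd2)

/-- The edge conductivity as an affine dependence of the four corners of the hinge, with positive
weights at the two corners opposite to the edge. -/
lemma IsHinge.exists_weights {K : PlaneComplex} {i j k l : Plane} (h : IsHinge K i j k l) :
    ∃ a b c d : ℝ, 0 < c ∧ 0 < d ∧ c + d = a + b ∧ c • k + d • l = a • i + b • j ∧
      ∀ s : Plane → ℝ, hingeConductivity s i j k l = c * s k + d * s l - a * s i - b * s j := by
  have hk := h.left.det_ne_zero
  have hl := h.right.det_ne_zero
  have hij := h.left.ne_ab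
  have hik := h.left.ne_ac
  have hjk := h.left.ne_bc
  have hil := h.right.ne_ac
  have hjl := h.right.ne_bc
  have hneg := h.det_mul_neg
  have hji : ∀ c, |det j i c| = |det i j c| := by
    intro c
    rw [show det j i c = - det i j c by unfold det; ring, abs_neg]
  have he : (dist i j) ^ 2 ≠ 0 := pow_ne_zero _ (dist_ne_zero.2 hij)
  have hform : ∀ s : Plane → ℝ, hingeConductivity s i j k l =
      1 / |det i j k| * s k + 1 / |det i j l| * s l
      - (1 / dist i j ^ 2) * (((i 0 - j 0) * (k 0 - j 0) + (i 1 - j 1) * (k 1 - j 1)) / |det i j k|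
        + ((i 0 - j 0) * (l 0 - j 0) + (i 1 - j 1) * (l 1 - j 1)) / |det i j l|) * s i
      - (1 / dist i j ^ 2) * (((j 0 - i 0) * (k 0 - i 0) + (j 1 - i 1) * (k 1 - i 1)) / |det i j k|
        + ((j 0 - i 0) * (l 0 - i 0) + (j 1 - i 1) * (l 1 - i 1)) / |det i j l|) * s j := by
    intro s
    rw [hingeConductivity, cot_angle hij hjk.symm, cot_angle hij hjl.symm,
      cot_angle hij.symm hik.symm, cot_angle hij.symm hil.symm, hji, hji, triangleArea_eq,
      triangleArea_eq]
    ring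
  have hsgn : (|det i j k| = det i j k ∧ |det i j l| = - det i j l) ∨
      (|det i j k| = - det i j k ∧ |det i j l| = det i j l) := by
    rcases hk.lt_or_gt with hk' | hk'
    · exact Or.inr ⟨abs_of_neg hk', abs_of_pos (by nlinarith)⟩
    · exact Or.inl ⟨abs_of_pos hk', abs_of_neg (by nlinarith)⟩
  -- The weights `a` and `b` are read off from `hform`. Both remaining identities need the opposite
  -- signs in `hsgn`.
  refine ⟨_, _, _, _, one_div_pos.2 (abs_pos.2 hk), one_div_pos.2 (abs_pos.2 hl), ?_, ?_, hform⟩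
  · rw [dist_sq_eq] at he ⊢
    rcases hsgn with ⟨h1, h2⟩ | ⟨h1, h2⟩ <;> rw [h1, h2] <;> field_simp <;> ring
  · rw [dist_sq_eq] at he ⊢
    apply plane_ext <;> simp only [PiLp.add_apply, PiLp.smul_apply, smul_eq_mul]
    all_goals
      rcases hsgn with ⟨h1, h2⟩ | ⟨h1, h2⟩ <;> rw [h1, h2] <;> field_simp <;>
      simp only [det] <;> ring

/-- For a function that agrees with an affine one on the edge of a hinge, the edge conductivity
only sees the two opposite corners. -/
lemma IsHinge.exists_weights_sub {K : PlaneComplex} {i j k l : Plane} (h : IsHinge K i j k l) :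
    ∃ c d : ℝ, 0 < c ∧ 0 < d ∧ ∀ (s : Plane → ℝ) (f : Plane →ᵃ[ℝ] ℝ), f i = s i → f j = s j →
      hingeConductivity s i j k l = c * (s k - f k) + d * (s l - f l) := by
  obtain ⟨a, b, c, d, hc, hd, hsum, hvec, hq⟩ := h.exists_weights
  refine ⟨c, d, hc, hd, fun s f hi hj => ?_⟩
  have hf : ∀ x, f x = f.linear x + f 0 := fun x => congrFun (AffineMap.decomp f) x
  have hlin := congrArg f.linear hvec
  simp only [map_add, map_smul, smul_eq_mul] at hlin
  rw [hq, ← hi, ← hj, hf k, hf l, hf i, hf j]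
  linear_combination hlin + f 0 * hsum

/-! ### Affine functions on simplices. -/

/-- An open set is not covered by finitely many proper affine subspaces. -/
lemma exists_mem_forall_notMem {U : Set Plane} (hU : IsOpen U) (hne : U.Nonempty)
    {ι : Type*} {I : Set ι} (hI : I.Finite) (A : ι → AffineSubspace ℝ Plane)
    (hA : ∀ i ∈ I, A i ≠ ⊤) : ∃ x ∈ U, ∀ i ∈ I, x ∉ A i := by
  by_contra! h
  have h0 : MeasureTheory.volume (⋃ i ∈ I, (A i : Set Plane)) = 0 :=
    (MeasureTheory.measure_biUnion_null_iff hI.countable).2 fun i hi =>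
      MeasureTheory.Measure.addHaar_affineSubspace _ _ (hA i hi)
  have hsub : U ⊆ ⋃ i ∈ I, (A i : Set Plane) := fun x hx => by
    obtain ⟨i, hi, hxi⟩ := h x hx
    exact Set.mem_biUnion hi hxi
  exact (hU.measure_pos MeasureTheory.volume hne).ne' (MeasureTheory.measure_mono_null hsub h0)

lemma affineMap_le_of_mem_convexHull {f g : Plane →ᵃ[ℝ] ℝ} {A : Set Plane} {x : Plane}
    (h : ∀ a ∈ A, f a ≤ g a) (hx : x ∈ convexHull ℝ A) : f x ≤ g x := by
  have hc : Convex ℝ ((f - g) ⁻¹' Set.Iic 0) := (convex_Iic (0 : ℝ)).affine_preimage (f - g)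
  have := convexHull_min (t := (f - g) ⁻¹' Set.Iic 0) (fun a ha => by simpa using h a ha) hc hx
  simpa using this

lemma affineMap_eq_of_mem_convexHull {f g : Plane →ᵃ[ℝ] ℝ} {A : Set Plane} {x : Plane}
    (h : ∀ a ∈ A, f a = g a) (hx : x ∈ convexHull ℝ A) : f x = g x :=
  le_antisymm (affineMap_le_of_mem_convexHull (fun a ha => (h a ha).le) hx)
    (affineMap_le_of_mem_convexHull (fun a ha => (h a ha).ge) hx)

lemma affineMap_sum (f : Plane →ᵃ[ℝ] ℝ) (t : Finset Plane) (w : Plane → ℝ)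
    (hw : ∑ y ∈ t, w y = 1) : f (∑ y ∈ t, w y • y) = ∑ y ∈ t, w y * f y := by
  have hf : ∀ x, f x = f.linear x + f 0 := fun x => congrFun (AffineMap.decomp f) x
  have hr : ∀ y ∈ t, w y * f y = w y * f.linear y + w y * f 0 := fun y _ => by
    rw [hf y, mul_add]
  rw [hf, map_sum, Finset.sum_congr rfl hr, Finset.sum_add_distrib, ← Finset.sum_mul, hw, one_mul]
  simp only [map_smul, smul_eq_mul]

/-- Affine functions with prescribed values on an affinely independent set. -/
lemma exists_affineMap_eq {t : Finset Plane} (ht : AffineIndependent ℝ ((↑) : t → Plane))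
    (w : Plane → ℝ) : ∃ f : Plane →ᵃ[ℝ] ℝ, ∀ v ∈ t, f v = w v := by
  obtain ⟨T, htT, hT, hspan⟩ := exists_subset_affineIndependent_affineSpan_eq_top
    (s := (t : Set Plane)) ht
  let b : AffineBasis T ℝ Plane := ⟨(↑), hT, by rw [Subtype.range_coe]; exact hspan⟩
  have hb : ∀ v (hv : v ∈ T) u (hu : u ∈ T), b.coord ⟨u, hu⟩ v = if u = v then 1 else 0 := by
    intro v hv u hu
    have := b.coord_apply ⟨u, hu⟩ ⟨v, hv⟩
    rw [show b ⟨v, hv⟩ = v from rfl] at this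
    rw [this]
    simp
  -- After extending `t` to an affine basis, combine its barycentric coordinates with the prescribed
  -- values.
  refine ⟨∑ u : t, w u • b.coord ⟨u, htT u.2⟩, fun v hv => ?_⟩
  have hsum : ∀ (s : Finset t) (F : t → Plane →ᵃ[ℝ] ℝ) (x : Plane),
      (∑ u ∈ s, F u) x = ∑ u ∈ s, F u x := by
    intro s F x
    induction s using Finset.induction_on with
    | empty => simp
    | insert a s ha ih => simp [Finset.sum_insert ha, ih]
  rw [hsum]
  simp only [AffineMap.coe_smul, Pi.smul_apply, smul_eq_mul]
  rw [Finset.sum_eq_single ⟨v, hv⟩]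
  · rw [hb v (htT hv)]; simp
  · rintro ⟨u, hu⟩ - huv
    rw [hb v (htT hv), if_neg, mul_zero]
    exact fun h => huv (Subtype.ext h)
  · simp

lemma exists_pos_weights {t : Finset Plane} (ht : t.Nonempty) :
    ∃ w : Plane → ℝ, (∀ v ∈ t, 0 < w v) ∧ ∑ v ∈ t, w v = 1 := by
  have : (t.card : ℝ) ≠ 0 := by exact_mod_cast ht.card_pos.ne'
  refine ⟨fun _ => 1 / t.card, fun v _ => one_div_pos.2 (by exact_mod_cast ht.card_pos), ?_⟩
  simp [this]

/-- A point in the relative interior of a simplex lies in no proper face. -/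
lemma subset_of_sum_mem_convexHull {t u : Finset Plane}
    (ht : AffineIndependent ℝ ((↑) : t → Plane)) {w : Plane → ℝ} (hw : ∀ v ∈ t, 0 < w v)
    (hw1 : ∑ v ∈ t, w v = 1)
    (hx : ∑ v ∈ t, w v • v ∈ convexHull ℝ (t ∩ u : Set Plane)) : t ⊆ u := by
  classical
  intro v hv
  by_contra hvu
  -- The barycentric coordinate of `v` vanishes on the hull of `t ∩ u`, yet equals `w v > 0` at the
  -- given point.
  obtain ⟨f, hf⟩ := exists_affineMap_eq ht (fun x => if x = v then 1 else 0)
  have h1 : f (∑ v ∈ t, w v • v) = 0 := by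
    refine (affineMap_eq_of_mem_convexHull (g := AffineMap.const ℝ Plane 0) ?_ hx).trans (by simp)
    rintro a ⟨ha, hau⟩
    rw [hf a ha, if_neg]
    · simp
    · rintro rfl
      exact hvu hau
  rw [affineMap_sum f t w hw1, Finset.sum_congr rfl fun x hx => by rw [hf x hx]] at h1
  simp [hv] at h1
  exact (hw v hv).ne' h1

lemma sum_mem_convexHull {t : Finset Plane} {w : Plane → ℝ} (hw : ∀ v ∈ t, 0 < w v)
    (hw1 : ∑ v ∈ t, w v = 1) : ∑ v ∈ t, w v • v ∈ convexHull ℝ (t : Set Plane) :=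
  Finset.mem_convexHull'.2 ⟨w, fun v hv => (hw v hv).le, hw1, rfl⟩

/-! ### Covering by triangles. -/

lemma card_le_three {t : Finset Plane} (ht : AffineIndependent ℝ ((↑) : t → Plane)) :
    t.card ≤ 3 := by
  have := ht.card_le_finrank_succ
  have h2 : Module.finrank ℝ (vectorSpan ℝ (Set.range ((↑) : t → Plane))) ≤ 2 := by
    simpa using Submodule.finrank_le (vectorSpan ℝ (Set.range ((↑) : t → Plane)))
  rw [Fintype.card_coe] at this
  omega

lemma affineSpan_ne_top_of_card_lt {t : Finset Plane} (ht : t.card < 3) :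
    affineSpan ℝ (t : Set Plane) ≠ ⊤ := by
  intro h
  have h1 : vectorSpan ℝ (t : Set Plane) = ⊤ := by
    rw [← direction_affineSpan, h, AffineSubspace.direction_top]
  have hne : t.Nonempty := by
    rw [Finset.nonempty_iff_ne_empty]
    rintro rfl
    simp at h
  have h2 := finrank_vectorSpan_image_finset_le ℝ (id : Plane → Plane) t (n := t.card - 1) (by
    have := hne.card_pos; omega)
  have h3 : vectorSpan ℝ ((t.image id : Finset Plane) : Set Plane) = ⊤ := by
    rw [Finset.image_id, h1]
  rw [h3, finrank_top] at h2
  simp at h2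
  omega

lemma interior_convexHull_nonempty {V : Finset Plane} (hV : ¬ Collinear ℝ (V : Set Plane)) :
    (interior (convexHull ℝ (V : Set Plane))).Nonempty := by
  rw [interior_convexHull_nonempty_iff_affineSpan_eq_top]
  have hne : (V : Set Plane).Nonempty := by
    rw [Set.nonempty_iff_ne_empty]
    intro h
    rw [h] at hV
    exact hV (collinear_empty ℝ Plane)
  rw [collinear_iff_finrank_le_one, not_le] at hV
  rw [AffineSubspace.affineSpan_eq_top_iff_vectorSpan_eq_top_of_nonempty ℝ Plane Plane hne]
  apply Submodule.eq_top_of_finrank_eq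
  have := Submodule.finrank_le (vectorSpan ℝ (V : Set Plane))
  simp at this ⊢
  omega

/-- If finitely many simplices cover the interior of the convex hull of `V`, then the
full-dimensional ones cover the convex hull. -/
lemma exists_triangle_of_cover {V : Finset Plane} (hV : ¬ Collinear ℝ (V : Set Plane))
    {F : Set (Finset Plane)} (hF : F.Finite)
    (hcov : ∀ x ∈ interior (convexHull ℝ (V : Set Plane)),
      ∃ t ∈ F, x ∈ convexHull ℝ (t : Set Plane))
    {x : Plane} (hx : x ∈ convexHull ℝ (V : Set Plane)) :
    ∃ t ∈ F, 3 ≤ t.card ∧ x ∈ convexHull ℝ (t : Set Plane) := by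
  by_contra! h
  -- `C` is closed. If it missed `x`, an open part of the interior would be covered by the remaining
  -- simplices, all of which lie in proper affine subspaces.
  set C := ⋃ t ∈ F ∩ {t | 3 ≤ t.card}, convexHull ℝ (t : Set Plane) with hC
  have hclosed : IsClosed C :=
    (hF.subset Set.inter_subset_left).isClosed_biUnion fun t _ =>
      t.finite_toSet.isClosed_convexHull ℝ
  have hxC : x ∈ Cᶜ := by
    intro hxC
    obtain ⟨t, ht, hxt⟩ := Set.mem_iUnion₂.1 hxC
    exact h t ht.1 ht.2 hxt
  have hcl : x ∈ closure (interior (convexHull ℝ (V : Set Plane))) := by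
    rw [(convex_convexHull ℝ _).closure_interior_eq_closure_of_nonempty_interior
      (interior_convexHull_nonempty hV)]
    exact subset_closure hx
  have hne := mem_closure_iff.1 hcl Cᶜ hclosed.isOpen_compl hxC
  obtain ⟨y, hy, hyn⟩ := exists_mem_forall_notMem (hclosed.isOpen_compl.inter isOpen_interior) hne
    (hF.subset Set.inter_subset_left : (F ∩ {t | t.card < 3}).Finite)
    (fun t => affineSpan ℝ (t : Set Plane)) fun t ht => affineSpan_ne_top_of_card_lt ht.2
  obtain ⟨t, ht, hyt⟩ := hcov y hy.2
  rcases lt_or_ge t.card 3 with h3 | h3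
  · exact hyn t ⟨ht, h3⟩ (convexHull_subset_affineSpan _ hyt)
  · exact hy.1 (Set.mem_biUnion (x := t) ⟨ht, h3⟩ hyt)

variable {V : Finset Plane} {K : PlaneComplex} {s : Plane → ℝ} {i j k l : Plane}

lemma IsTriangulation.subset (h : IsTriangulation V K) {t : Finset Plane} (ht : t ∈ K.faces) :
    t ⊆ V := by
  intro v hv
  have : v ∈ K.vertices := by
    rw [Geometry.SimplicialComplex.vertices_eq]
    exact Set.mem_biUnion ht hv
  rw [h.vertices_eq] at this
  exact this

lemma IsTriangulation.finite_faces (h : IsTriangulation V K) : K.faces.Finite :=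
  V.powerset.finite_toSet.subset fun _ ht => Finset.mem_coe.2 (Finset.mem_powerset.2 (h.subset ht))

lemma IsTriangulation.exists_triangle (h : IsTriangulation V K)
    (hV : ¬ Collinear ℝ (V : Set Plane)) {x : Plane} (hx : x ∈ convexHull ℝ (V : Set Plane)) :
    ∃ t ∈ K.faces, t.card = 3 ∧ x ∈ convexHull ℝ (t : Set Plane) := by
  obtain ⟨t, ht, h3, hxt⟩ := exists_triangle_of_cover hV h.finite_faces (fun y hy => by
    have : y ∈ K.space := by
      rw [h.space_eq]
      exact interior_subset hy
    exact Geometry.SimplicialComplex.mem_space_iff.1 this) hx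
  exact ⟨t, ht, le_antisymm (card_le_three (K.indep ht)) h3, hxt⟩

/-- Every face of a triangulation is a face of a triangle. -/
lemma IsTriangulation.exists_superset (h : IsTriangulation V K)
    (hV : ¬ Collinear ℝ (V : Set Plane)) {t : Finset Plane} (ht : t ∈ K.faces) :
    ∃ T ∈ K.faces, T.card = 3 ∧ t ⊆ T := by
  obtain ⟨w, hw, hw1⟩ := exists_pos_weights (K.nonempty_of_mem_faces ht)
  have hxt := sum_mem_convexHull hw hw1
  obtain ⟨T, hT, h3, hxT⟩ := h.exists_triangle hV
    (convexHull_mono (Finset.coe_subset.2 (h.subset ht)) hxt)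
  exact ⟨T, hT, h3, subset_of_sum_mem_convexHull (K.indep ht) hw hw1
    (K.inter_subset_convexHull ht hT ⟨hxt, hxT⟩)⟩

lemma IsTriangle.exists_affineMap {a b c : Plane} (h : IsTriangle K a b c) (x y z : ℝ) :
    ∃ f : Plane →ᵃ[ℝ] ℝ, f a = x ∧ f b = y ∧ f c = z := by
  classical
  obtain ⟨t, ht, htt⟩ := h.face
  have hmem : ∀ v, v ∈ t ↔ v = a ∨ v = b ∨ v = c := fun v => by
    rw [← Finset.mem_coe, htt]; simp
  obtain ⟨f, hf⟩ := exists_affineMap_eq (K.indep ht)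
    (fun v => if v = a then x else if v = b then y else z)
  refine ⟨f, ?_, ?_, ?_⟩
  · rw [hf a (by simp [hmem])]; simp
  · rw [hf b (by simp [hmem])]; simp [h.ne_ab.symm]
  · rw [hf c (by simp [hmem])]; simp [h.ne_ac.symm, h.ne_bc.symm]

/-! ### The sign of the conductivity and the shape of the lifted hinge. -/

lemma IsHinge.conductivity_pos_iff (h : IsHinge K i j k l) :
    0 < hingeConductivity s i j k l ↔ HingeConvex s i j k l := by
  obtain ⟨c, d, hc, hd, hq⟩ := h.exists_weights_sub
  constructor
  · intro hpos
    -- The value at `k` is chosen so that `k` accounts for half of the conductivity; the other half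
    -- is left for `l`.
    obtain ⟨f, hi, hj, hk⟩ := h.left.exists_affineMap (s i) (s j)
      (s k - hingeConductivity s i j k l / (2 * c))
    have h1 := hq s f hi hj
    rw [hk] at h1
    have h2 : c * (s k - (s k - hingeConductivity s i j k l / (2 * c))) =
        hingeConductivity s i j k l / 2 := by
      field_simp
      ring
    rw [h2] at h1
    refine ⟨f, hi, hj, ?_, ?_⟩
    · rw [hk]
      have : 0 < hingeConductivity s i j k l / (2 * c) := by positivity
      linarith
    · have : 0 < d * (s l - f l) := by linarith
      linarith [(pos_iff_pos_of_mul_pos this).1 hd]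
  · rintro ⟨f, hi, hj, hk, hl⟩
    rw [hq s f hi hj]
    exact add_pos (mul_pos hc (sub_pos.2 hk)) (mul_pos hd (sub_pos.2 hl))

lemma IsHinge.conductivity_eq_zero_iff (h : IsHinge K i j k l) :
    hingeConductivity s i j k l = 0 ↔ HingeFlat s i j k l := by
  obtain ⟨c, d, hc, hd, hq⟩ := h.exists_weights_sub
  constructor
  · intro h0
    obtain ⟨f, hi, hj, hk⟩ := h.left.exists_affineMap (s i) (s j) (s k)
    have h1 := hq s f hi hj
    rw [h0, hk, sub_self, mul_zero, zero_add] at h1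
    refine ⟨f, hi, hj, hk, ?_⟩
    have := (mul_eq_zero.1 h1.symm).resolve_left hd.ne'
    linarith
  · rintro ⟨f, hi, hj, hk, hl⟩
    rw [hq s f hi hj, hk, hl]
    simp

/-! ### Projections of the lower hull are `Q`-adapted. -/

/-- A convex combination of lifted points. -/
lemma sum_lift_mem_convexHull {t : Finset Plane} {w : Plane → ℝ} (hw : ∀ v ∈ t, 0 ≤ w v)
    (hw1 : ∑ v ∈ t, w v = 1) :
    ((∑ v ∈ t, w v • v, ∑ v ∈ t, w v * s v) : Plane × ℝ) ∈
      convexHull ℝ (lift s '' (t : Set Plane)) := by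
  have : ((∑ v ∈ t, w v • v, ∑ v ∈ t, w v * s v) : Plane × ℝ) = ∑ v ∈ t, w v • lift s v := by
    apply Prod.ext
    · simp [lift, Prod.fst_sum]
    · simp [lift, Prod.snd_sum]
  rw [this]
  exact (convex_convexHull ℝ _).sum_mem hw hw1 fun v hv =>
    subset_convexHull ℝ _ (Set.mem_image_of_mem _ hv)

/-- A projection of the lower hull is `Q`-adapted. -/
lemma IsLowerHullProjection.isQAdapted (hK : IsLowerHullProjection s V K) : IsQAdapted s K := by
  classical
  intro i j k l h
  obtain ⟨a, b, c, d, hc, hd, hsum, hvec, hq⟩ := h.exists_weights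
  obtain ⟨t, ht, htt⟩ := h.left.face
  obtain ⟨u, hu, huu⟩ := h.right.face
  have hV : ∀ t ∈ K.faces, ∀ v ∈ t, v ∈ V := fun t ht v hv => by
    have : v ∈ K.vertices := by
      rw [Geometry.SimplicialComplex.vertices_eq]
      exact Set.mem_biUnion ht hv
    exact hK.vertices_subset this
  have memt : ∀ v, v ∈ t ↔ v = i ∨ v = j ∨ v = k := fun v => by
    rw [← Finset.mem_coe, htt]; simp
  have memu : ∀ v, v ∈ u ↔ v = i ∨ v = j ∨ v = l := fun v => by
    rw [← Finset.mem_coe, huu]; simp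
  have hi := hV t ht i (by simp [memt])
  have hj := hV t ht j (by simp [memt])
  have hk := hV t ht k (by simp [memt])
  have hl := hV u hu l (by simp [memu])
  have hedge : ({i, j} : Finset Plane) ∈ K.faces := K.down_closed ht (by
    intro v hv
    rw [memt]
    simp at hv
    tauto) (by simp)
  set C := convexHull ℝ (lift s '' (V : Set Plane)) with hC
  have hCc : Convex ℝ C := convex_convexHull ℝ _
  have hCm : ∀ v ∈ V, lift s v ∈ C := fun v hv =>
    subset_convexHull ℝ _ (Set.mem_image_of_mem _ hv)
  have hmid : (1 / 2 : ℝ) • lift s i + (1 / 2 : ℝ) • lift s j ∈ lowerHull s V := by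
    rw [← hK.lift_eq]
    refine Set.mem_biUnion hedge ?_
    refine (convex_convexHull ℝ _) ?_ ?_ (by norm_num) (by norm_num) (by norm_num)
    · exact subset_convexHull ℝ _ ⟨i, by simp, rfl⟩
    · exact subset_convexHull ℝ _ ⟨j, by simp, rfl⟩
  -- Small enough that moving the midpoint by `ε` times the affine dependence keeps all weights
  -- nonnegative. The move fixes the planar point and changes the height by `ε` times the
  -- conductivity.
  set ε : ℝ := 1 / (2 + 2 * |a| + 2 * |b|) with hε'
  have hε : 0 < ε := by positivity
  have hεm : ε * (2 + 2 * |a| + 2 * |b|) = 1 := one_div_mul_cancel (by positivity)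
  have h1 : 0 ≤ 1 / 2 - ε * a := by
    nlinarith [mul_nonneg hε.le (abs_nonneg b), mul_nonneg hε.le (sub_nonneg.2 (le_abs_self a))]
  have h2 : 0 ≤ 1 / 2 - ε * b := by
    nlinarith [mul_nonneg hε.le (abs_nonneg a), mul_nonneg hε.le (sub_nonneg.2 (le_abs_self b))]
  have hmem : (1 / 2 - ε * a) • lift s i + (1 / 2 - ε * b) • lift s j + (ε * c) • lift s k
      + (ε * d) • lift s l ∈ C := by
    have := hCc.sum_mem (t := Finset.univ)
      (w := ![1 / 2 - ε * a, 1 / 2 - ε * b, ε * c, ε * d])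
      (z := ![lift s i, lift s j, lift s k, lift s l]) ?_ ?_ ?_
    · simpa [Fin.sum_univ_four] using this
    · intro m _
      fin_cases m
      · exact h1
      · exact h2
      · exact (mul_pos hε hc).le
      · exact (mul_pos hε hd).le
    · simp [Fin.sum_univ_four]
      linear_combination ε * hsum
    · intro m _
      fin_cases m
      · exact hCm i hi
      · exact hCm j hj
      · exact hCm k hk
      · exact hCm l hl
  have heq : (1 / 2 - ε * a) • lift s i + (1 / 2 - ε * b) • lift s j + (ε * c) • lift s k
      + (ε * d) • lift s l = (((1 / 2 : ℝ) • lift s i + (1 / 2 : ℝ) • lift s j).1,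
        1 / 2 * s i + 1 / 2 * s j + ε * hingeConductivity s i j k l) := by
    apply Prod.ext
    · have : ε • (c • k + d • l) = ε • (a • i + b • j) := by rw [hvec]
      simp only [lift, Prod.fst_add, Prod.smul_fst]
      have h4 := sub_eq_zero.2 this
      rw [← sub_eq_zero, ← h4]
      module
    · simp only [lift, Prod.snd_add, Prod.smul_snd, smul_eq_mul, hq]
      ring
  rw [heq] at hmem
  have := hmid.2 _ hmem
  simp only [lift, Prod.snd_add, Prod.smul_snd, smul_eq_mul] at this
  have h3 : 0 ≤ ε * hingeConductivity s i j k l := by linarith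
  exact nonneg_of_mul_nonneg_right h3 hε

/-! ### From local to global convexity. -/

/-- Two different triangles that share two corners form a hinge. -/
lemma exists_isHinge {T T' : Finset Plane} (hT : T ∈ K.faces) (hT' : T' ∈ K.faces)
    (h3 : T.card = 3) (h3' : T'.card = 3) (hne : T ≠ T') (hI : ∃ A ⊆ T, A ⊆ T' ∧ 2 ≤ A.card) :
    ∃ i j k l, IsHinge K i j k l ∧ (T : Set Plane) = {i, j, k} ∧ (T' : Set Plane) = {i, j, l} := by
  classical
  obtain ⟨A, hA, hA', h2⟩ := hI
  obtain ⟨B, hB, hB2⟩ := Finset.exists_subset_card_eq h2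
  obtain ⟨i, j, hij, rfl⟩ := Finset.card_eq_two.1 hB2
  have aux : ∀ S : Finset Plane, S.card = 3 → ({i, j} : Finset Plane) ⊆ S →
      ∃ m, m ≠ i ∧ m ≠ j ∧ S = {i, j, m} := by
    intro S hS hsub
    have h1 : (S \ {i, j}).card = 1 := by rw [Finset.card_sdiff_of_subset hsub, hS, hB2]
    obtain ⟨m, hm⟩ := Finset.card_eq_one.1 h1
    have hmS : m ∈ S \ {i, j} := by rw [hm]; simp
    simp only [Finset.mem_sdiff, Finset.mem_insert, Finset.mem_singleton, not_or] at hmS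
    refine ⟨m, hmS.2.1, hmS.2.2, ?_⟩
    rw [← Finset.sdiff_union_of_subset hsub, hm]
    ext x
    simp only [Finset.mem_union, Finset.mem_insert, Finset.mem_singleton]
    tauto
  obtain ⟨k, hki, hkj, rfl⟩ := aux T h3 (hB.trans hA)
  obtain ⟨l, hli, hlj, rfl⟩ := aux T' h3' (hB.trans hA')
  refine ⟨i, j, k, l, ⟨⟨hij, hkj.symm, hki.symm, _, hT, by simp⟩,
    ⟨hij, hlj.symm, hli.symm, _, hT', by simp⟩, ?_⟩, by simp, by simp⟩
  rintro rfl
  exact hne rfl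

/-- Equal averages of termwise ordered values are equal term by term, so a vertex with `f v < g v`
carries weight zero. -/
lemma mem_convexHull_filter {f g : Plane →ᵃ[ℝ] ℝ} {t : Finset Plane} {x : Plane}
    (h : ∀ v ∈ t, f v ≤ g v) (hx : x ∈ convexHull ℝ (t : Set Plane)) (hfg : f x = g x) :
    x ∈ convexHull ℝ {v | v ∈ t ∧ f v = g v} := by
  classical
  obtain ⟨w, hw, hw1, rfl⟩ := Finset.mem_convexHull'.1 hx
  rw [affineMap_sum f t w hw1, affineMap_sum g t w hw1] at hfg
  have h0 := (Finset.sum_eq_sum_iff_of_le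
    (fun v hv => mul_le_mul_of_nonneg_left (h v hv) (hw v hv))).1 hfg
  have hz : ∀ v ∈ t, v ∉ t.filter (fun v => f v = g v) → w v = 0 := by
    intro v hv hv'
    by_contra hwv
    exact hv' (Finset.mem_filter.2 ⟨hv, mul_left_cancel₀ hwv (h0 v hv)⟩)
  have hmem : ∑ v ∈ t.filter (fun v => f v = g v), w v • v ∈
      convexHull ℝ ((t.filter (fun v => f v = g v) : Finset Plane) : Set Plane) := by
    refine Finset.mem_convexHull'.2 ⟨w, fun v hv => hw v (Finset.mem_filter.1 hv).1, ?_, rfl⟩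
    rw [← hw1]
    exact Finset.sum_subset (Finset.filter_subset _ _) hz
  rw [Finset.sum_subset (Finset.filter_subset _ _) (fun v hv hv' => by
    rw [hz v hv hv', zero_smul])] at hmem
  simpa using hmem

/-- Where a line segment towards `v` leaves a triangle `T` and enters the triangle `T'`, the
interpolating affine functions of the two triangles differ at `v` by a positive multiple of the
conductivity of the common edge. -/
lemma exists_interpolation_add {T T' : Finset Plane} (hV : ∀ t ∈ K.faces, t ⊆ V)
    (hT : T ∈ K.faces) (hT' : T' ∈ K.faces) (h3 : T.card = 3) (h3' : T'.card = 3)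
    {f : Plane →ᵃ[ℝ] ℝ} (hf : ∀ u ∈ T, f u = s u) {x v : Plane} {τ τ' : ℝ} (hτ : τ < τ')
    (hτ1 : τ' ≤ 1) (hx : AffineMap.lineMap x v τ ∈ convexHull ℝ (T : Set Plane))
    (hx' : AffineMap.lineMap x v τ ∈ convexHull ℝ (T' : Set Plane))
    (hy : AffineMap.lineMap x v τ' ∉ convexHull ℝ (T : Set Plane))
    (hy' : AffineMap.lineMap x v τ' ∈ convexHull ℝ (T' : Set Plane))
    (hxV : AffineMap.lineMap x v τ ∉ V) :
    ∃ f' : Plane →ᵃ[ℝ] ℝ, (∀ u ∈ T', f' u = s u) ∧ ∃ c > 0, ∃ i j k l, IsHinge K i j k l ∧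
      f' v = f v + c * hingeConductivity s i j k l := by
  classical
  have hcap := K.inter_subset_convexHull hT hT' ⟨hx, hx'⟩
  have hne : T ≠ T' := by
    rintro rfl
    exact hy hy'
  -- With a single common vertex, the crossing point would be that vertex, hence a point of `V`.
  have h2 : 2 ≤ (T ∩ T').card := by
    by_contra hlt
    rw [← Finset.coe_inter] at hcap
    obtain hc | hc : (T ∩ T').card = 0 ∨ (T ∩ T').card = 1 := by omega
    · rw [Finset.card_eq_zero.1 hc] at hcap
      simp at hcap
    · obtain ⟨a, ha⟩ := Finset.card_eq_one.1 hc
      rw [ha, Finset.coe_singleton, convexHull_singleton, Set.mem_singleton_iff] at hcap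
      have : a ∈ T ∩ T' := by rw [ha]; simp
      exact hxV (hcap ▸ hV T hT (Finset.mem_inter.1 this).1)
  obtain ⟨i, j, k, l, h, hTe, hTe'⟩ := exists_isHinge hT hT' h3 h3' hne
    ⟨T ∩ T', Finset.inter_subset_left, Finset.inter_subset_right, h2⟩
  obtain ⟨c, d, hc, hd, hq⟩ := h.exists_weights_sub
  -- `g` vanishes at the crossing point and is positive a little later, so it increases along the
  -- segment and is positive at `v`. The new interpolant is `f` plus a multiple of `g`.
  obtain ⟨g, hgi, hgj, hgl⟩ := h.right.exists_affineMap 0 0 1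
  have memT : ∀ u, u ∈ T ↔ u = i ∨ u = j ∨ u = k := fun u => by
    rw [← Finset.mem_coe, hTe]; simp
  have memT' : ∀ u, u ∈ T' ↔ u = i ∨ u = j ∨ u = l := fun u => by
    rw [← Finset.mem_coe, hTe']; simp
  have hi := hf i (by simp [memT])
  have hj := hf j (by simp [memT])
  have hk := hf k (by simp [memT])
  have hqs := hq s f hi hj
  rw [hk, sub_self, mul_zero, zero_add] at hqs
  have hg0 : ∀ u ∈ T', 0 ≤ g u := by
    intro u hu
    rcases (memT' u).1 hu with rfl | rfl | rfl
    · exact hgi.ge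
    · exact hgj.ge
    · rw [hgl]; exact zero_le_one
  have hgx : g (AffineMap.lineMap x v τ) = 0 := by
    refine (affineMap_eq_of_mem_convexHull (g := AffineMap.const ℝ Plane 0) ?_ hcap).trans
      (by simp)
    rintro u ⟨hu, hu'⟩
    rcases (memT u).1 hu with rfl | rfl | rfl
    · simpa using hgi
    · simpa using hgj
    · rcases (memT' u).1 hu' with h' | h' | h'
      · exact absurd h'.symm h.left.ne_ac
      · exact absurd h'.symm h.left.ne_bc
      · exact absurd h' h.ne
  have hgy : 0 < g (AffineMap.lineMap x v τ') := by
    have hle : 0 ≤ g (AffineMap.lineMap x v τ') := by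
      simpa using affineMap_le_of_mem_convexHull (f := AffineMap.const ℝ Plane 0) (g := g)
        (by simpa using hg0) hy'
    refine lt_of_le_of_ne hle fun h0 => hy ?_
    have := mem_convexHull_filter (f := AffineMap.const ℝ Plane 0) (g := g)
        (by simpa using hg0) hy' (by simpa using h0)
    refine convexHull_mono ?_ this
    rintro u ⟨hu, hu0⟩
    rcases (memT' u).1 hu with rfl | rfl | rfl
    · simp [memT]
    · simp [memT]
    · rw [hgl] at hu0
      simp at hu0
  have hgv : 0 < g v := by
    rw [AffineMap.apply_lineMap, AffineMap.lineMap_apply, vsub_eq_sub, vadd_eq_add,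
      smul_eq_mul] at hgx hgy
    have h1 : 0 < (τ' - τ) * (g v - g x) := by linarith
    have h2 : 0 < g v - g x := (pos_iff_pos_of_mul_pos h1).1 (sub_pos.2 hτ)
    nlinarith
  refine ⟨f + (s l - f l) • g, ?_, g v / d, div_pos hgv hd, i, j, k, l, h, ?_⟩
  · intro u hu
    rcases (memT' u).1 hu with rfl | rfl | rfl
    · simp [hgi, hi]
    · simp [hgj, hj]
    · simp [hgl]
  · rw [hqs]
    simp
    field_simp

/-- The segment towards `v` that leaves a triangle enters a neighbouring one. -/
lemma IsTriangulation.exists_next (hK : IsTriangulation V K)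
    (hV : ¬ Collinear ℝ (V : Set Plane)) {T : Finset Plane} (hT : T ∈ K.faces) (h3 : T.card = 3)
    {f : Plane →ᵃ[ℝ] ℝ} (hf : ∀ u ∈ T, f u = s u) {x v : Plane}
    (hxV : x ∈ convexHull ℝ (V : Set Plane)) (hv : v ∈ V) {τ : ℝ} (hτ0 : 0 ≤ τ) (hτ1 : τ < 1)
    (hx : AffineMap.lineMap x v τ ∈ convexHull ℝ (T : Set Plane))
    (hlast : ∀ τ', τ < τ' → τ' ≤ 1 → AffineMap.lineMap x v τ' ∉ convexHull ℝ (T : Set Plane))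
    (hτV : AffineMap.lineMap x v τ ∉ V) :
    ∃ T' ∈ K.faces, T'.card = 3 ∧
      (∃ τ', τ < τ' ∧ τ' ≤ 1 ∧ AffineMap.lineMap x v τ' ∈ convexHull ℝ (T' : Set Plane)) ∧
      ∃ f' : Plane →ᵃ[ℝ] ℝ, (∀ u ∈ T', f' u = s u) ∧ ∃ c > 0, ∃ i j k l, IsHinge K i j k l ∧
        f' v = f v + c * hingeConductivity s i j k l := by
  have hcont : Continuous (AffineMap.lineMap x v : ℝ → Plane) := AffineMap.lineMap_continuous
  -- Faces are closed and finite in number, so a triangle containing a slightly later point also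
  -- contains the current one.
  have h1 : ∀ᶠ τ' in 𝓝[>] τ, ∀ T' ∈ K.faces,
      AffineMap.lineMap x v τ ∉ convexHull ℝ (T' : Set Plane) →
        AffineMap.lineMap x v τ' ∉ convexHull ℝ (T' : Set Plane) := by
    rw [Filter.eventually_all_finite hK.finite_faces]
    intro T' _
    by_cases hmem : AffineMap.lineMap x v τ ∈ convexHull ℝ (T' : Set Plane)
    · exact Eventually.of_forall fun _ h => absurd hmem h
    · have hopen := ((T'.finite_toSet.isClosed_convexHull ℝ).preimage hcont).isOpen_compl
      filter_upwards [nhdsWithin_le_nhds (hopen.mem_nhds hmem)] with τ' h _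
      exact h
  obtain ⟨τ', h1, hτ'⟩ := (h1.and (Ioc_mem_nhdsGT hτ1)).exists
  obtain ⟨T', hT', h3', hy'⟩ := hK.exists_triangle hV
    ((convex_convexHull ℝ _).lineMap_mem hxV (subset_convexHull ℝ _ hv)
      (⟨hτ0.trans hτ'.1.le, hτ'.2⟩ : τ' ∈ Set.Icc (0 : ℝ) 1))
  have hx' : AffineMap.lineMap x v τ ∈ convexHull ℝ (T' : Set Plane) := by
    by_contra h
    exact h1 T' hT' h hy'
  exact ⟨T', hT', h3', ⟨τ', hτ'.1, hτ'.2, hy'⟩,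
    exists_interpolation_add (fun _ => hK.subset) hT hT' h3 h3' hf hτ'.1 hτ'.2 hx hx'
      (hlast τ' hτ'.1 hτ'.2) hy' hτV⟩

/-- A point of a triangle from which the segments to `v` avoid all other points of `V`. -/
lemma exists_generic_point {T : Finset Plane} (hT : T ∈ K.faces) (h3 : T.card = 3)
    (V : Finset Plane) (v : Plane) : ∃ x ∈ convexHull ℝ (T : Set Plane),
      ∀ τ : ℝ, τ < 1 → AffineMap.lineMap x v τ ∉ V := by
  classical
  -- Avoid the lines joining `v` to the points of `V`.
  obtain ⟨x, hx, hxn⟩ := exists_mem_forall_notMem isOpen_interior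
    (interior_convexHull_nonempty (not_collinear_of_indep (K.indep hT) h3)) V.finite_toSet
    (fun u => affineSpan ℝ (({v, u} : Finset Plane) : Set Plane))
    (fun u _ => affineSpan_ne_top_of_card_lt (lt_of_le_of_lt Finset.card_le_two (by norm_num)))
  refine ⟨x, interior_subset hx, fun τ hτ hmem => hxn _ hmem ?_⟩
  have h1 : (1 : ℝ) - τ ≠ 0 := by linarith
  have hxe : x = AffineMap.lineMap v (AffineMap.lineMap x v τ) (1 / (1 - τ)) := by
    simp only [AffineMap.lineMap_apply, vsub_eq_sub, vadd_eq_add]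
    rw [show τ • (v - x) + x - v = (1 - τ) • (x - v) by module, smul_smul,
      one_div_mul_cancel h1]
    simp
  have hmem' := AffineMap.lineMap_mem_affineSpan_pair (1 / (1 - τ)) v
    (AffineMap.lineMap x v τ : Plane)
  rw [← hxe] at hmem'
  simpa using hmem'

/-- The last point of a segment that lies in a finite family of simplices. -/
lemma exists_last {F : Set (Finset Plane)} (hF : F.Finite) {x v : Plane}
    (hx : ∃ t ∈ F, x ∈ convexHull ℝ (t : Set Plane)) :
    ∃ τ : ℝ, 0 ≤ τ ∧ τ ≤ 1 ∧ ∃ t ∈ F, AffineMap.lineMap x v τ ∈ convexHull ℝ (t : Set Plane) ∧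
      ∀ τ', τ < τ' → τ' ≤ 1 → ∀ t ∈ F,
        AffineMap.lineMap x v τ' ∉ convexHull ℝ (t : Set Plane) := by
  have hcont : Continuous (AffineMap.lineMap x v : ℝ → Plane) := AffineMap.lineMap_continuous
  have hclosed : IsClosed (⋃ t ∈ F, convexHull ℝ (t : Set Plane)) :=
    hF.isClosed_biUnion fun t _ => t.finite_toSet.isClosed_convexHull ℝ
  have hcomp : IsCompact (Set.Icc (0 : ℝ) 1 ∩
      (AffineMap.lineMap x v : ℝ → Plane) ⁻¹' ⋃ t ∈ F, convexHull ℝ (t : Set Plane)) :=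
    isCompact_Icc.inter_right (hclosed.preimage hcont)
  obtain ⟨t, ht, hxt⟩ := hx
  obtain ⟨τ, ⟨hτ, hmem⟩, hub⟩ := hcomp.exists_isGreatest
    ⟨0, ⟨le_rfl, zero_le_one⟩, Set.mem_biUnion ht (by simpa using hxt)⟩
  obtain ⟨t, ht, hxt⟩ := Set.mem_iUnion₂.1 hmem
  refine ⟨τ, hτ.1, hτ.2, t, ht, hxt, fun τ' h1 h2 t' ht' hmem' => ?_⟩
  exact h1.not_ge (hub ⟨⟨hτ.1.trans h1.le, h2⟩, Set.mem_biUnion ht' hmem'⟩)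

lemma IsTriangulation.mem_of_mem_convexHull (hK : IsTriangulation V K) {v : Plane} (hv : v ∈ V)
    {t : Finset Plane} (ht : t ∈ K.faces) (h : v ∈ convexHull ℝ (t : Set Plane)) : v ∈ t :=
  (Geometry.SimplicialComplex.vertex_mem_convexHull_iff (by rw [hK.vertices_eq]; exact hv) ht).1 h

/-- Local convexity implies global convexity: the interpolating affine functions on the triangles
of a `Q`-adapted triangulation bound `s` from below. -/
lemma IsTriangulation.interpolation_le (hK : IsTriangulation V K)
    (hV : ¬ Collinear ℝ (V : Set Plane)) (hQ : IsQAdapted s K) {T : Finset Plane}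
    (hT : T ∈ K.faces) (h3 : T.card = 3) {f : Plane →ᵃ[ℝ] ℝ} (hf : ∀ u ∈ T, f u = s u)
    {v : Plane} (hv : v ∈ V) : f v ≤ s v := by
  obtain ⟨x, hxT, hx⟩ := exists_generic_point hT h3 V v
  have hxV := convexHull_mono (Finset.coe_subset.2 (hK.subset hT)) hxT
  -- The family consists of the triangles whose interpolant at `v` is at least `f v`. Were its last
  -- point on the segment before `v`, the next triangle would belong to it too. Compactness thus
  -- replaces an induction over the triangles crossed.
  obtain ⟨τ, hτ0, hτ1, t, ⟨ht, ht3, g, hg, hfg⟩, hxt, hlast⟩ := exists_last (v := v)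
    (F := {t | t ∈ K.faces ∧ t.card = 3 ∧
      ∃ g : Plane →ᵃ[ℝ] ℝ, (∀ u ∈ t, g u = s u) ∧ f v ≤ g v})
    (hK.finite_faces.subset fun t ht => ht.1) ⟨T, ⟨hT, h3, f, hf, le_rfl⟩, hxT⟩
  rcases hτ1.lt_or_eq with hlt | rfl
  · obtain ⟨T', hT', h3', ⟨τ', h1, h2, hmem⟩, f', hf', c, hc, i, j, k, l, hh, heq⟩ :=
      hK.exists_next hV ht ht3 hg hxV hv hτ0 hlt hxt
        (fun τ' h1 h2 => hlast τ' h1 h2 t ⟨ht, ht3, g, hg, hfg⟩) (hx τ hlt)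
    refine absurd hmem (hlast τ' h1 h2 T' ⟨hT', h3', f', hf', hfg.trans ?_⟩)
    rw [heq]
    exact le_add_of_nonneg_right (mul_nonneg hc.le (hQ _ _ _ _ hh))
  · rw [AffineMap.lineMap_apply_one] at hxt
    rw [← hg v (hK.mem_of_mem_convexHull hv ht hxt)]
    exact hfg

/-- Leaving `T` crosses an edge of positive conductivity, which strictly raises the value at `v`;
from the neighbouring triangle on, the weak bound suffices. -/
lemma IsTriangulation.interpolation_lt (hK : IsTriangulation V K)
    (hV : ¬ Collinear ℝ (V : Set Plane)) (hQ : IsQAdapted s K)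
    (hne : ∀ i j k l, IsHinge K i j k l → hingeConductivity s i j k l ≠ 0) {T : Finset Plane}
    (hT : T ∈ K.faces) (h3 : T.card = 3) {f : Plane →ᵃ[ℝ] ℝ} (hf : ∀ u ∈ T, f u = s u)
    {v : Plane} (hv : v ∈ V) (hvT : v ∉ T) : f v < s v := by
  obtain ⟨x, hxT, hx⟩ := exists_generic_point hT h3 V v
  have hxV := convexHull_mono (Finset.coe_subset.2 (hK.subset hT)) hxT
  obtain ⟨τ, hτ0, hτ1, t, rfl, hxt, hlast⟩ := exists_last (v := v) (F := {T})
    (Set.finite_singleton T) ⟨T, rfl, hxT⟩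
  rcases hτ1.lt_or_eq with hlt | rfl
  · obtain ⟨T', hT', h3', -, f', hf', c, hc, i, j, k, l, hh, heq⟩ :=
      hK.exists_next hV hT h3 hf hxV hv hτ0 hlt hxt
        (fun τ' h1 h2 => hlast τ' h1 h2 t rfl) (hx τ hlt)
    have h1 := hK.interpolation_le hV hQ hT' h3' hf' hv
    have h2 := mul_pos hc (lt_of_le_of_ne (hQ _ _ _ _ hh) (hne _ _ _ _ hh).symm)
    linarith
  · rw [AffineMap.lineMap_apply_one] at hxt
    exact absurd (hK.mem_of_mem_convexHull hv hT hxt) hvT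

/-! ### Uniqueness. -/

/-- A `Q`-adapted triangulation without vanishing conductivities is the only `Q`-adapted one. -/
lemma IsTriangulation.eq_of_isQAdapted (hV : ¬ Collinear ℝ (V : Set Plane))
    (hK : IsTriangulation V K) (hQ : IsQAdapted s K)
    (hne : ∀ i j k l, IsHinge K i j k l → hingeConductivity s i j k l ≠ 0)
    {K' : PlaneComplex} (hK' : IsTriangulation V K') (hQ' : IsQAdapted s K') : K' = K := by
  have hsub : ∀ t ∈ K'.faces, t ∈ K.faces := by
    intro t ht
    obtain ⟨T', hT', h3', htT'⟩ := hK'.exists_superset hV ht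
    obtain ⟨g, hg⟩ := exists_affineMap_eq (K'.indep hT') s
    have hgle : ∀ v ∈ V, g v ≤ s v := fun v => hK'.interpolation_le hV hQ' hT' h3' hg
    obtain ⟨w, hw, hw1⟩ := exists_pos_weights (K'.nonempty_of_mem_faces ht)
    have hxt := sum_mem_convexHull hw hw1
    obtain ⟨T, hT, h3, hxT⟩ := hK.exists_triangle hV
      (convexHull_mono (Finset.coe_subset.2 (hK'.subset ht)) hxt)
    obtain ⟨f, hf⟩ := exists_affineMap_eq (K.indep hT) s
    have hfle : ∀ v ∈ t, f v ≤ g v := fun v hv => by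
      rw [hg v (htT' hv)]
      exact hK.interpolation_le hV hQ hT h3 hf (hK'.subset ht hv)
    -- On `t`, `f ≤ s = g`; on `T`, `g ≤ s = f`; the point lies in both hulls.
    have heq : f (∑ v ∈ t, w v • v) = g (∑ v ∈ t, w v • v) :=
      le_antisymm (affineMap_le_of_mem_convexHull hfle hxt)
        (affineMap_le_of_mem_convexHull (fun v hv => by
          rw [hf v hv]
          exact hgle v (hK.subset hT hv)) hxT)
    have hmem := mem_convexHull_filter hfle hxt heq
    refine K.down_closed hT (subset_of_sum_mem_convexHull (K'.indep ht) hw hw1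
      (convexHull_mono ?_ hmem)) (K'.nonempty_of_mem_faces ht)
    rintro v ⟨hv, hfg⟩
    refine ⟨hv, ?_⟩
    by_contra hvT
    have := hK.interpolation_lt hV hQ hne hT h3 hf (hK'.subset ht hv) hvT
    rw [hfg, hg v (htT' hv)] at this
    exact lt_irrefl _ this
  -- A triangle of `K'` through a relative interior point of `t` is already a face of `K`, so it
  -- contains `t`.
  have hsup : ∀ t ∈ K.faces, t ∈ K'.faces := by
    intro t ht
    obtain ⟨w, hw, hw1⟩ := exists_pos_weights (K.nonempty_of_mem_faces ht)
    have hxt := sum_mem_convexHull hw hw1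
    obtain ⟨T, hT, -, hxT⟩ := hK'.exists_triangle hV
      (convexHull_mono (Finset.coe_subset.2 (hK.subset ht)) hxt)
    exact K'.down_closed hT (subset_of_sum_mem_convexHull (K.indep ht) hw hw1
      (K.inter_subset_convexHull ht (hsub T hT) ⟨hxt, hxT⟩)) (K.nonempty_of_mem_faces ht)
  exact Geometry.SimplicialComplex.ext (Set.ext fun t => ⟨hsub t, hsup t⟩)

/-! ### Regular triangulations from affine minorants. -/

/-- A point of the interior of the convex hull of `V` lies in the convex hull of the contact set
of some affine minorant. -/
lemma exists_support (V : Finset Plane) (w : Plane → ℝ) {x : Plane}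
    (hx : x ∈ interior (convexHull ℝ (V : Set Plane))) :
    ∃ f : Plane →ᵃ[ℝ] ℝ, (∀ v ∈ V, f v ≤ w v) ∧
      x ∈ convexHull ℝ {v | v ∈ V ∧ f v = w v} := by
  classical
  let G : Plane × ℝ → Plane →ᵃ[ℝ] ℝ := fun p =>
    ((innerSL ℝ p.1 : Plane →L[ℝ] ℝ) : Plane →ₗ[ℝ] ℝ).toAffineMap +
      AffineMap.const ℝ Plane (p.2 - inner ℝ p.1 x)
  have hG : ∀ p y, G p y = inner ℝ p.1 (y - x) + p.2 := by
    intro p y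
    simp [G, inner_sub_right]
    ring
  obtain ⟨M, hM⟩ : ∃ M : ℝ, ∀ v ∈ V, |w v| ≤ M :=
    ⟨∑ v ∈ V, |w v|, fun v hv => Finset.single_le_sum (fun u _ => abs_nonneg (w u)) hv⟩
  have hVne : V.Nonempty := by
    rw [Finset.nonempty_iff_ne_empty]
    rintro rfl
    simp at hx
  have hM0 : 0 ≤ M := by
    obtain ⟨v, hv⟩ := hVne
    exact (abs_nonneg _).trans (hM v hv)
  obtain ⟨r, hr, hball⟩ := Metric.isOpen_iff.1 isOpen_interior x hx
  -- `G p` has slope `p.1` and value `p.2` at `x`. A ball around `x` inside the hull bounds the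
  -- slopes, so `D` is compact and some minorant has the largest value at `x`.
  set D : Set (Plane × ℝ) := {p | (∀ v ∈ V, G p v ≤ w v) ∧ -M ≤ p.2} with hD
  have hle : ∀ p ∈ D, ∀ y ∈ convexHull ℝ (V : Set Plane), G p y ≤ M := fun p hp y hy => by
    simpa using affineMap_le_of_mem_convexHull (f := G p) (g := AffineMap.const ℝ Plane M)
      (fun v hv => (hp.1 v hv).trans (by simpa using (le_abs_self _).trans (hM v hv))) hy
  have hbdd : Bornology.IsBounded D := by
    refine (Metric.isBounded_closedBall (x := (0 : Plane)) (r := 4 * M / r)).prod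
      (Metric.isBounded_Icc (-M) M) |>.subset ?_
    rintro ⟨a, b⟩ hp
    have hb : b ≤ M := by
      have := hle _ hp x (interior_subset hx)
      rw [hG] at this
      simpa using this
    refine ⟨?_, hp.2, hb⟩
    rw [mem_closedBall_zero_iff, le_div_iff₀ hr]
    rcases eq_or_ne a 0 with rfl | ha
    · simpa using hM0
    have hna : 0 < ‖a‖ := norm_pos_iff.2 ha
    have hy : x + (r / (2 * ‖a‖)) • a ∈ convexHull ℝ (V : Set Plane) := by
      refine interior_subset (hball ?_)
      rw [mem_ball_iff_norm, add_sub_cancel_left, norm_smul, Real.norm_of_nonneg (by positivity)]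
      field_simp
      linarith
    have := hle _ hp _ hy
    rw [hG, add_sub_cancel_left, inner_smul_right, real_inner_self_eq_norm_sq] at this
    have h2 : r / (2 * ‖a‖) * ‖a‖ ^ 2 = ‖a‖ * r / 2 := by
      field_simp
    simp only [h2] at this
    have := hp.2
    simp only at this
    linarith
  have hclosed : IsClosed D := by
    have h1 : D = (⋂ v ∈ V, {p : Plane × ℝ | inner ℝ p.1 (v - x) + p.2 ≤ w v}) ∩
        {p | -M ≤ p.2} := by
      ext p
      simp [hD, hG]
    rw [h1]
    refine IsClosed.inter (isClosed_biInter fun v _ => ?_) (isClosed_le (by fun_prop) (by fun_prop))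
    exact isClosed_le (by fun_prop) (by fun_prop)
  have hne : D.Nonempty := ⟨(0, -M), fun v hv => by
    rw [hG]
    simpa using neg_le_of_abs_le (hM v hv), le_rfl⟩
  obtain ⟨⟨a, b⟩, hp, hmax⟩ := (Metric.isCompact_of_isClosed_isBounded hclosed hbdd).exists_isMaxOn
    hne (f := Prod.snd) (by fun_prop)
  refine ⟨G (a, b), hp.1, ?_⟩
  by_contra hxA
  have hAfin : {v | v ∈ V ∧ G (a, b) v = w v}.Finite := V.finite_toSet.subset fun v hv => hv.1
  -- Adding a small multiple of `u - φ` raises the minorant at `x` and lowers it at the contact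
  -- points; all other points have slack. This contradicts maximality.
  obtain ⟨φ, u, hφx, hφ⟩ := geometric_hahn_banach_point_closed (convex_convexHull ℝ _)
    (hAfin.isClosed_convexHull ℝ) hxA
  set p := (InnerProductSpace.toDual ℝ Plane).symm φ with hpdef
  have hpφ : ∀ y, inner ℝ p y = φ y := fun y => by simp [hpdef]
  have hnew : ∀ ε y, G (a - ε • p, b + ε * (u - φ x)) y = G (a, b) y + ε * (u - φ y) := by
    intro ε y
    simp only [hG, inner_sub_left, inner_smul_left, inner_sub_right, hpφ]
    simp
    ring
  have hev : ∀ᶠ ε in 𝓝[>] (0 : ℝ), ∀ v ∈ V, G (a, b) v + ε * (u - φ v) ≤ w v := by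
    rw [Filter.eventually_all_finset]
    intro v hv
    rcases (hp.1 v hv).lt_or_eq with hlt | heq
    · have ht : Tendsto (fun ε : ℝ => G (a, b) v + ε * (u - φ v)) (𝓝 0) (𝓝 (G (a, b) v)) := by
        have : Continuous (fun ε : ℝ => G (a, b) v + ε * (u - φ v)) := by fun_prop
        simpa using this.tendsto 0
      filter_upwards [nhdsWithin_le_nhds (ht.eventually (gt_mem_nhds hlt))] with ε hε
      exact hε.le
    · have := hφ v (subset_convexHull ℝ _ ⟨hv, heq⟩)
      filter_upwards [self_mem_nhdsWithin] with ε hε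
      have hε' : (0 : ℝ) < ε := hε
      rw [heq]
      nlinarith
  obtain ⟨ε, hε, hεpos⟩ := (hev.and self_mem_nhdsWithin).exists
  have hεpos' : (0 : ℝ) < ε := hεpos
  have hgain : 0 < ε * (u - φ x) := mul_pos hεpos' (by linarith)
  have hmem : (a - ε • p, b + ε * (u - φ x)) ∈ D := by
    refine ⟨fun v hv => ?_, ?_⟩
    · rw [hnew]
      exact hε v hv
    · have := hp.2
      simp only at this ⊢
      linarith
  have := hmax hmem
  simp only [Set.mem_ofPred_eq] at this
  linarith

/-- The regular triangulation given by a generic height function. -/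
lemma exists_regular_triangulation (hV : ¬ Collinear ℝ (V : Set Plane)) (w : Plane → ℝ)
    (hgen : ∀ A ⊆ V, ∀ f : Plane →ᵃ[ℝ] ℝ, (∀ v ∈ A, f v = w v) →
      AffineIndependent ℝ ((↑) : A → Plane))
    (hconv : ∀ u ∈ V, ∀ A ⊆ V, ∀ f : Plane →ᵃ[ℝ] ℝ, (∀ v ∈ A, f v = w v) →
      u ∈ convexHull ℝ (A : Set Plane) → w u ≤ f u) :
    ∃ K : PlaneComplex, IsTriangulation V K ∧ ∀ t ∈ K.faces,
      ∃ f : Plane →ᵃ[ℝ] ℝ, (∀ v ∈ V, f v ≤ w v) ∧ ∀ v ∈ t, f v = w v := by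
  classical
  let F : Set (Finset Plane) := {t | t.Nonempty ∧ t ⊆ V ∧
    ∃ f : Plane →ᵃ[ℝ] ℝ, (∀ v ∈ V, f v ≤ w v) ∧ ∀ v ∈ t, f v = w v}
  let K : PlaneComplex :=
    { faces := F
      isRelLowerSet_faces := by
        rintro t ⟨hne, ht, f, hf, hft⟩
        exact ⟨hne, fun u hu hune => ⟨hune, hu.trans ht, f, hf, fun v hv => hft v (hu hv)⟩⟩
      indep := by
        rintro t ⟨hne, ht, f, hf, hft⟩
        exact hgen t ht f hft
      inter_subset_convexHull := by
        rintro t₁ t₂ ⟨-, ht₁, f₁, hf₁, hft₁⟩ ⟨-, ht₂, f₂, hf₂, hft₂⟩ x ⟨hx₁, hx₂⟩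
        have hle : ∀ v ∈ t₁, f₂ v ≤ f₁ v := fun v hv => by
          rw [hft₁ v hv]; exact hf₂ v (ht₁ hv)
        -- Equality at `x` moves the problem into a single contact set: `x` lies in the hull of the
        -- vertices `B` of `t₁` that touch `f₂`, and `B` and `t₂` are both subsets of the affinely
        -- independent contact set of `f₂`.
        have heq : f₂ x = f₁ x := le_antisymm (affineMap_le_of_mem_convexHull hle hx₁)
          (affineMap_le_of_mem_convexHull (fun v hv => by
            rw [hft₂ v hv]; exact hf₁ v (ht₂ hv)) hx₂)
        have hB := mem_convexHull_filter hle hx₁ heq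
        set B := t₁.filter (fun v => f₂ v = f₁ v) with hBdef
        have hBc : x ∈ convexHull ℝ (B : Set Plane) := by
          simpa [hBdef] using hB
        have hA := hgen (V.filter fun v => f₂ v = w v) (Finset.filter_subset _ _) f₂
          fun v hv => (Finset.mem_filter.1 hv).2
        have hcap := hA.convexHull_inter (t₁ := B) (t₂ := t₂)
          (fun v hv => by
            have hv' := Finset.mem_filter.1 hv
            exact Finset.mem_filter.2 ⟨ht₁ hv'.1, hv'.2.trans (hft₁ v hv'.1)⟩)
          (fun v hv => Finset.mem_filter.2 ⟨ht₂ hv, hft₂ v hv⟩)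
        have hx : x ∈ convexHull ℝ (B ∩ t₂ : Set Plane) := by
          rw [hcap]; exact ⟨hBc, hx₂⟩
        exact convexHull_mono (Set.inter_subset_inter_left _
          (Finset.coe_subset.2 (Finset.filter_subset _ _))) hx }
  have hFfin : F.Finite := V.powerset.finite_toSet.subset fun t ht =>
    Finset.mem_coe.2 (Finset.mem_powerset.2 ht.2.1)
  have hcov : ∀ x ∈ convexHull ℝ (V : Set Plane),
      ∃ t ∈ F, x ∈ convexHull ℝ (t : Set Plane) := by
    intro x hx
    obtain ⟨t, ht, -, hxt⟩ := exists_triangle_of_cover hV hFfin (fun y hy => by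
      obtain ⟨f, hf, hyf⟩ := exists_support V w hy
      have hyf' : y ∈ convexHull ℝ ((V.filter fun v => f v = w v : Finset Plane) : Set Plane) := by
        simpa using hyf
      refine ⟨V.filter fun v => f v = w v, ⟨?_, Finset.filter_subset _ _, f, hf,
        fun v hv => (Finset.mem_filter.1 hv).2⟩, hyf'⟩
      rw [← Finset.coe_nonempty]
      exact convexHull_nonempty_iff.1 ⟨y, hyf'⟩) hx
    exact ⟨t, ht, hxt⟩
  refine ⟨K, ⟨?_, ?_⟩, fun t ht => ht.2.2⟩
  · ext v
    rw [Geometry.SimplicialComplex.mem_vertices]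
    constructor
    · intro hv
      exact hv.2.1 (Finset.mem_singleton_self v)
    · intro hv
      obtain ⟨t, ⟨-, ht, f, hf, hft⟩, hvt⟩ := hcov v (subset_convexHull ℝ _ hv)
      refine ⟨Finset.singleton_nonempty v, Finset.singleton_subset_iff.2 hv, f, hf, fun u hu => ?_⟩
      rw [Finset.mem_singleton.1 hu]
      exact le_antisymm (hf v hv) (hconv v hv t ht f hft hvt)
  · ext x
    rw [Geometry.SimplicialComplex.mem_space_iff]
    constructor
    · rintro ⟨t, ht, hxt⟩
      exact convexHull_mono (Finset.coe_subset.2 ht.2.1) hxt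
    · exact hcov x

/-! ### Supporting functions and the lower hull. -/

/-- A triangulation whose faces support `s` from below is a projection of the lower hull. -/
lemma IsTriangulation.isLowerHullProjection (hK : IsTriangulation V K)
    (hsupp : ∀ t ∈ K.faces, ∃ f : Plane →ᵃ[ℝ] ℝ, (∀ v ∈ V, f v ≤ s v) ∧ ∀ v ∈ t, f v = s v) :
    IsLowerHullProjection s V K := by
  have hbelow : ∀ (f : Plane →ᵃ[ℝ] ℝ) (A : Set Plane), (∀ v ∈ A, f v ≤ s v) →
      ∀ p ∈ convexHull ℝ (lift s '' A), f p.1 ≤ p.2 := by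
    intro f A hf p hp
    let g : Plane × ℝ →ᵃ[ℝ] ℝ := f.comp (LinearMap.fst ℝ Plane ℝ).toAffineMap -
      (LinearMap.snd ℝ Plane ℝ).toAffineMap
    have hg : ∀ p, g p = f p.1 - p.2 := fun p => rfl
    have := convexHull_min (t := g ⁻¹' Set.Iic 0) (by
      rintro _ ⟨v, hv, rfl⟩
      simpa [hg, lift] using hf v hv) ((convex_Iic (0 : ℝ)).affine_preimage g) hp
    simpa [hg] using this
  have hfst : ∀ (A : Set Plane), ∀ p ∈ convexHull ℝ (lift s '' A), p.1 ∈ convexHull ℝ A := by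
    intro A p hp
    have h1 := Set.mem_image_of_mem (LinearMap.fst ℝ Plane ℝ) hp
    rw [LinearMap.image_convexHull, Set.image_image] at h1
    simpa [lift] using h1
  have hgraph : ∀ t : Finset Plane, ∀ f : Plane →ᵃ[ℝ] ℝ, (∀ v ∈ t, f v = s v) →
      ∀ x ∈ convexHull ℝ (t : Set Plane), (x, f x) ∈ convexHull ℝ (lift s '' (t : Set Plane)) := by
    intro t f hf x hx
    obtain ⟨w, hw, hw1, rfl⟩ := Finset.mem_convexHull'.1 hx
    have hr : ∀ v ∈ t, w v * f v = w v * s v := fun v hv => by rw [hf v hv]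
    rw [affineMap_sum f t w hw1, Finset.sum_congr rfl hr]
    exact sum_lift_mem_convexHull hw hw1
  refine ⟨hK.vertices_eq.subset, ?_⟩
  ext p
  constructor
  · intro hp
    obtain ⟨t, ht, hpt⟩ := Set.mem_iUnion₂.1 hp
    obtain ⟨f, hf, hft⟩ := hsupp t ht
    have hmono : convexHull ℝ (lift s '' (t : Set Plane)) ⊆
        convexHull ℝ (lift s '' (V : Set Plane)) :=
      convexHull_mono (Set.image_mono (Finset.coe_subset.2 (hK.subset ht)))
    refine ⟨hmono hpt, fun z hz => ?_⟩
    have h1 := hbelow f V hf _ hz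
    have h2 : p.2 ≤ f p.1 := by
      let g : Plane × ℝ →ᵃ[ℝ] ℝ := (LinearMap.snd ℝ Plane ℝ).toAffineMap -
        f.comp (LinearMap.fst ℝ Plane ℝ).toAffineMap
      have hg : ∀ p, g p = p.2 - f p.1 := fun p => rfl
      have := convexHull_min (t := g ⁻¹' Set.Iic 0) (by
        rintro _ ⟨v, hv, rfl⟩
        simpa [hg, lift] using (hft v hv).ge) ((convex_Iic (0 : ℝ)).affine_preimage g) hpt
      simpa [hg] using this
    exact h2.trans h1
  · rintro ⟨hpC, hmin⟩
    have hx : p.1 ∈ K.space := by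
      rw [hK.space_eq]
      exact hfst _ p hpC
    obtain ⟨t, ht, hxt⟩ := Geometry.SimplicialComplex.mem_space_iff.1 hx
    obtain ⟨f, hf, hft⟩ := hsupp t ht
    have hmem := hgraph t f hft p.1 hxt
    have h1 := hmin _ (convexHull_mono (Set.image_mono (Finset.coe_subset.2 (hK.subset ht))) hmem)
    have h2 := hbelow f V hf p hpC
    refine Set.mem_biUnion ht ?_
    rwa [show p = (p.1, f p.1) from Prod.ext rfl (le_antisymm h1 h2)]

/-! ### Generic perturbation and existence. -/

lemma exists_affine_dependence {A : Finset Plane}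
    (hA : ¬ AffineIndependent ℝ ((↑) : A → Plane)) :
    ∃ μ : Plane → ℝ, ∑ v ∈ A, μ v = 0 ∧ ∑ v ∈ A, μ v • v = 0 ∧ ∃ v ∈ A, μ v ≠ 0 := by
  classical
  rw [affineIndependent_iff_of_fintype] at hA
  push Not at hA
  obtain ⟨w, hw0, hw, ⟨u, hu⟩, hwu⟩ := hA
  rw [Finset.weightedVSub_eq_linear_combination _ hw0] at hw
  refine ⟨fun v => if h : v ∈ A then w ⟨v, h⟩ else 0, ?_, ?_, u, hu, by simpa [hu] using hwu⟩
  · rw [← Finset.sum_coe_sort, ← hw0]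
    exact Finset.sum_congr rfl fun e _ => by simp
  · rw [← Finset.sum_coe_sort, ← hw]
    exact Finset.sum_congr rfl fun e _ => by simp

/-- A function that satisfies no non-trivial affine dependence of the points of `V`. -/
lemma exists_generic (V : Finset Plane) (μ : Finset Plane → Plane → ℝ)
    (hμ : ∀ A ⊆ V, ¬ AffineIndependent ℝ ((↑) : A → Plane) → ∃ v ∈ A, μ A v ≠ 0) :
    ∃ ψ : Plane → ℝ, ∀ A ⊆ V, ¬ AffineIndependent ℝ ((↑) : A → Plane) →
      ∑ v ∈ A, μ A v * ψ v ≠ 0 := by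
  classical
  let ι := {A : V.powerset // ¬ AffineIndependent ℝ (fun v : (A : Finset Plane) => (v : Plane))}
  let m : ι → Plane →₀ ℝ := fun A => ∑ v ∈ (A.1 : Finset Plane), Finsupp.single v (μ A.1 v)
  have hm : ∀ A, m A ≠ 0 := by
    intro A h0
    obtain ⟨v, hv, hne⟩ := hμ A.1 (Finset.mem_powerset.1 A.1.2) A.2
    apply hne
    have := DFunLike.congr_fun h0 v
    simpa [m, Finsupp.finsetSum_apply, Finsupp.single_apply, hv] using this
  -- One linear functional is nonzero on finitely many nonzero vectors; its values on the basis give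
  -- `ψ`.
  obtain ⟨φ, hφ⟩ := Module.exists_dual_forall_apply_ne_zero (K := ℝ) m hm
  refine ⟨fun v => φ (Finsupp.single v 1), fun A hA hdep => ?_⟩
  have := hφ ⟨⟨A, Finset.mem_powerset.2 hA⟩, hdep⟩
  simp only [m, map_sum] at this
  convert this using 2 with v hv
  rw [← smul_eq_mul, ← map_smul, Finsupp.smul_single, smul_eq_mul, mul_one]

lemma eventually_pos_of_pos {a : ℝ} (b c : ℝ) (ha : 0 < a) :
    ∀ᶠ ε in 𝓝[>] (0 : ℝ), 0 < a + ε * b + ε ^ 2 * c := by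
  have hc : Continuous (fun ε : ℝ => a + ε * b + ε ^ 2 * c) := by fun_prop
  have ht : Tendsto (fun ε : ℝ => a + ε * b + ε ^ 2 * c) (𝓝 0) (𝓝 a) := by
    simpa using hc.tendsto 0
  exact nhdsWithin_le_nhds (ht.eventually (lt_mem_nhds ha))

/-- The nonzero coefficient of lowest order decides the sign for small `ε > 0`. -/
lemma eventually_ne_zero (a b : ℝ) {c : ℝ} (hc : c ≠ 0) :
    ∀ᶠ ε in 𝓝[>] (0 : ℝ), a + ε * b + ε ^ 2 * c ≠ 0 := by
  rcases lt_trichotomy a 0 with ha | rfl | ha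
  · filter_upwards [eventually_pos_of_pos (-b) (-c) (neg_pos.2 ha)] with ε h h0
    linarith
  · rcases lt_trichotomy b 0 with hb | rfl | hb
    · filter_upwards [eventually_pos_of_pos (-c) 0 (neg_pos.2 hb), self_mem_nhdsWithin]
        with ε h hε h0
      have hε' : (0 : ℝ) < ε := hε
      nlinarith
    · filter_upwards [self_mem_nhdsWithin] with ε hε
      have hε' : (0 : ℝ) < ε := hε
      simpa using ⟨hε'.ne', hc⟩
    · filter_upwards [eventually_pos_of_pos c 0 hb, self_mem_nhdsWithin] with ε h hε h0
      have hε' : (0 : ℝ) < ε := hε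
      nlinarith
  · filter_upwards [eventually_pos_of_pos b c ha] with ε h
    exact h.ne'

lemma affineSpan_eq_top {t : Finset Plane} (ht : AffineIndependent ℝ ((↑) : t → Plane))
    (h3 : t.card = 3) : affineSpan ℝ (t : Set Plane) = ⊤ :=
  interior_convexHull_nonempty_iff_affineSpan_eq_top.1
    (interior_convexHull_nonempty (not_collinear_of_indep ht h3))

/-- The perturbed heights inherit the convexity of `s`. -/
lemma perturbation_le (hs : ConvexOn ℝ (convexHull ℝ (V : Set Plane)) s) {ψ : Plane → ℝ} {ε : ℝ}
    (hε : 0 < ε) (h : ∀ u ∈ V, ∀ v ∈ V, 0 ≤ ‖v - u‖ ^ 2 + ε * (ψ v - ψ u)) {u : Plane}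
    (hu : u ∈ V) {A : Finset Plane} (hA : A ⊆ V) {f : Plane →ᵃ[ℝ] ℝ}
    (hf : ∀ v ∈ A, f v = s v + ε * ‖v‖ ^ 2 + ε ^ 2 * ψ v)
    (huA : u ∈ convexHull ℝ (A : Set Plane)) : s u + ε * ‖u‖ ^ 2 + ε ^ 2 * ψ u ≤ f u := by
  obtain ⟨w, hw, hw1, hwu⟩ := Finset.mem_convexHull'.1 huA
  have hsu : s u ≤ ∑ v ∈ A, w v * s v := by
    have := hs.map_sum_le (t := A) (w := w) (p := fun v => v) hw hw1
      (fun v hv => subset_convexHull ℝ _ (hA hv))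
    rwa [hwu] at this
  have hfu : f u = ∑ v ∈ A, w v * (s v + ε * ‖v‖ ^ 2 + ε ^ 2 * ψ v) := by
    rw [← hwu, affineMap_sum f A w hw1]
    exact Finset.sum_congr rfl fun v hv => by rw [hf v hv]
  have hin : ∑ v ∈ A, w v * inner ℝ v u = ‖u‖ ^ 2 := by
    rw [← real_inner_self_eq_norm_sq]
    nth_rewrite 2 [← hwu]
    rw [sum_inner]
    exact Finset.sum_congr rfl fun v _ => by rw [real_inner_smul_left]
  -- The quadratic term exceeds its tangent at `u` by `‖v - u‖ ^ 2`, which by `h` absorbs the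
  -- variation of `ψ`.
  have hterm : ∀ v ∈ A, w v * s v + ε * (2 * (w v * inner ℝ v u) - w v * ‖u‖ ^ 2)
      + ε ^ 2 * (w v * ψ u) ≤ w v * (s v + ε * ‖v‖ ^ 2 + ε ^ 2 * ψ v) := by
    intro v hv
    have h1 := mul_nonneg (hw v hv) (mul_nonneg hε.le (h u hu v (hA hv)))
    rw [norm_sub_sq_real] at h1
    linarith
  have hsum := Finset.sum_le_sum hterm
  rw [← hfu] at hsum
  simp only [Finset.sum_add_distrib, ← Finset.mul_sum, Finset.sum_sub_distrib, ← Finset.sum_mul,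
    hw1, hin] at hsum
  linarith

/-- Some triangulation of `V` is a projection of the lower hull. -/
lemma exists_isLowerHullProjection (hV : ¬ Collinear ℝ (V : Set Plane))
    (hs : ConvexOn ℝ (convexHull ℝ (V : Set Plane)) s) :
    ∃ K : PlaneComplex, IsTriangulation V K ∧ IsLowerHullProjection s V K := by
  classical
  have hdep : ∀ A : Finset Plane, ∃ μ : Plane → ℝ, ¬ AffineIndependent ℝ ((↑) : A → Plane) →
      ∑ v ∈ A, μ v = 0 ∧ ∑ v ∈ A, μ v • v = 0 ∧ ∃ v ∈ A, μ v ≠ 0 := by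
    intro A
    by_cases hA : AffineIndependent ℝ ((↑) : A → Plane)
    · exact ⟨0, fun h => absurd hA h⟩
    · obtain ⟨μ, hμ⟩ := exists_affine_dependence hA
      exact ⟨μ, fun _ => hμ⟩
  choose μ hμ using hdep
  obtain ⟨ψ, hψ⟩ := exists_generic V μ fun A _ hA => (hμ A hA).2.2
  have hint : ∀ (g : Plane → ℝ) (A : Finset Plane), ∃ f : Plane →ᵃ[ℝ] ℝ,
      AffineIndependent ℝ ((↑) : A → Plane) → ∀ v ∈ A, f v = g v := by
    intro g A
    by_cases hA : AffineIndependent ℝ ((↑) : A → Plane)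
    · obtain ⟨f, hf⟩ := exists_affineMap_eq hA g
      exact ⟨f, fun _ => hf⟩
    · exact ⟨0, fun h => absurd h hA⟩
  choose F hF using hint
  set q : Plane → ℝ := fun v => ‖v‖ ^ 2 with hq
  -- The perturbed heights violate the chosen dependence of every dependent subset, so no affine
  -- function interpolates them there.
  have e1 : ∀ᶠ ε in 𝓝[>] (0 : ℝ), ∀ A ∈ V.powerset, ¬ AffineIndependent ℝ ((↑) : A → Plane) →
      ∑ v ∈ A, μ A v * s v + ε * ∑ v ∈ A, μ A v * q v + ε ^ 2 * ∑ v ∈ A, μ A v * ψ v ≠ 0 := by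
    rw [Filter.eventually_all_finset]
    intro A hA
    by_cases hi : AffineIndependent ℝ ((↑) : A → Plane)
    · exact Eventually.of_forall fun _ h => absurd hi h
    · filter_upwards [eventually_ne_zero (∑ v ∈ A, μ A v * s v) (∑ v ∈ A, μ A v * q v)
        (hψ A (Finset.mem_powerset.1 hA) hi)] with ε h _
      exact h
  have e2 : ∀ᶠ ε in 𝓝[>] (0 : ℝ), ∀ u ∈ V, ∀ v ∈ V, 0 ≤ ‖v - u‖ ^ 2 + ε * (ψ v - ψ u) := by
    rw [Filter.eventually_all_finset]
    intro u _
    rw [Filter.eventually_all_finset]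
    intro v _
    rcases eq_or_ne v u with rfl | hne
    · exact Eventually.of_forall fun _ => by simp
    · have : 0 < ‖v - u‖ ^ 2 := pow_pos (norm_pos_iff.2 (sub_ne_zero.2 hne)) 2
      filter_upwards [eventually_pos_of_pos (ψ v - ψ u) 0 this] with ε h
      linarith
  -- Strict failure of support for `s` persists under the perturbation; read backwards, support of
  -- the perturbed heights passes to `s`.
  have e3 : ∀ᶠ ε in 𝓝[>] (0 : ℝ), ∀ A ∈ V.powerset, ∀ v ∈ V, s v < F s A v →
      s v + ε * q v + ε ^ 2 * ψ v < F s A v + ε * F q A v + ε ^ 2 * F ψ A v := by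
    rw [Filter.eventually_all_finset]
    intro A _
    rw [Filter.eventually_all_finset]
    intro v _
    by_cases hlt : s v < F s A v
    · filter_upwards [eventually_pos_of_pos (F q A v - q v) (F ψ A v - ψ v) (sub_pos.2 hlt)]
        with ε h _
      linarith
    · exact Eventually.of_forall fun _ h => absurd h hlt
  obtain ⟨ε, ⟨⟨h1, h2⟩, h3⟩, hε⟩ := (((e1.and e2).and e3).and self_mem_nhdsWithin).exists
  have hε' : (0 : ℝ) < ε := hε
  obtain ⟨K, hK, hsupp⟩ := exists_regular_triangulation hV
    (fun v => s v + ε * q v + ε ^ 2 * ψ v) (fun A hA f hf => by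
      by_contra hi
      refine h1 A (Finset.mem_powerset.2 hA) hi ?_
      obtain ⟨hm0, hm1, -⟩ := hμ A hi
      have hlin : ∑ v ∈ A, μ A v * f v = 0 := by
        have hr : ∀ v ∈ A, μ A v * f v = f.linear (μ A v • v) + μ A v * f 0 := fun v _ => by
          rw [show f v = f.linear v + f 0 from congrFun (AffineMap.decomp f) v, map_smul,
            smul_eq_mul, mul_add]
        rw [Finset.sum_congr rfl hr, Finset.sum_add_distrib, ← map_sum, hm1, ← Finset.sum_mul, hm0]
        simp
      rw [← hlin, Finset.mul_sum, Finset.mul_sum, ← Finset.sum_add_distrib,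
        ← Finset.sum_add_distrib]
      refine Finset.sum_congr rfl fun v hv => ?_
      rw [hf v hv]
      ring)
    fun u hu A hA f hf huA => perturbation_le hs hε' h2 hu hA hf huA
  refine ⟨K, hK, hK.isLowerHullProjection fun t ht => ?_⟩
  obtain ⟨T, hT, hT3, htT⟩ := hK.exists_superset hV ht
  have hi := K.indep hT
  obtain ⟨f, hf, hfT⟩ := hsupp T hT
  -- An affine function is determined by its values on a triangle, which is why the face was
  -- enlarged to `T`.
  have hfeq : f = F s T + ε • F q T + ε ^ 2 • F ψ T := by
    refine AffineMap.ext_on (affineSpan_eq_top hi hT3) fun v hv => ?_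
    rw [hfT v hv]
    simp [hF _ T hi v hv]
  refine ⟨F s T, fun v hv => ?_, fun v hv => hF s T hi v (htT hv)⟩
  by_contra! hlt
  have := h3 T (Finset.mem_powerset.2 (hK.subset hT)) v hv hlt
  have hle := hf v hv
  rw [hfeq] at hle
  simp at hle
  linarith

end QAdapted

theorem mainTheorem7 (V : Finset QAdapted.Plane)
    (hV : ¬ Collinear ℝ (V : Set QAdapted.Plane))
    (s : QAdapted.Plane → ℝ)
    (hs : ConvexOn ℝ (convexHull ℝ (V : Set QAdapted.Plane)) s) :
    (∃ K : QAdapted.PlaneComplex,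
      QAdapted.IsTriangulation V K ∧ QAdapted.IsLowerHullProjection s V K ∧
        QAdapted.IsQAdapted s K) ∧
    (∀ K : QAdapted.PlaneComplex,
      QAdapted.IsLowerHullProjection s V K → QAdapted.IsQAdapted s K) ∧
    (∀ (K : QAdapted.PlaneComplex) (i j k l : QAdapted.Plane), QAdapted.IsHinge K i j k l →
      (0 < QAdapted.hingeConductivity s i j k l ↔ QAdapted.HingeConvex s i j k l) ∧
      (QAdapted.hingeConductivity s i j k l = 0 ↔ QAdapted.HingeFlat s i j k l)) ∧
    (∀ K : QAdapted.PlaneComplex,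
      QAdapted.IsTriangulation V K → QAdapted.IsQAdapted s K →
      (∀ i j k l : QAdapted.Plane, QAdapted.IsHinge K i j k l →
        QAdapted.hingeConductivity s i j k l ≠ 0) →
      ∀ K' : QAdapted.PlaneComplex,
        QAdapted.IsTriangulation V K' → QAdapted.IsQAdapted s K' → K' = K) := by
  obtain ⟨K, hK, hproj⟩ := QAdapted.exists_isLowerHullProjection hV hs
  exact ⟨⟨K, hK, hproj, hproj.isQAdapted⟩, fun _ hK' => hK'.isQAdapted,
    fun _ _ _ _ _ h => ⟨h.conductivity_pos_iff, h.conductivity_eq_zero_iff⟩,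
    fun _ hK hQ hne _ hK' hQ' => hK.eq_of_isQAdapted hV hQ hne hK' hQ'⟩
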